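/- An additively separable hedonic game (ASHG) consists of $n$ agents and of integers $v_i(j)$ for all agents $i,j$, with $v_i(i)=0$; the values need not be symmetric. Agent $i$ values a coalition $C\ni i$ at $\sum_{j\in C}v_i(j)$. A coalition structure $\pi$ is a partition of the set of agents into nonempty coalitions; it is individually rational (IR) if every agent values its coalition $\pi(i)$ at least as much as the coalition $\{i\}$, i.e. $\sum_{j\in\pi(i)}v_i(j)\ge 0$. The preference graph $G$ has the agents as vertices and an edge between $i\ne j$ whenever $v_i(j)\neq 0$ or $v_j(i)\ne 0$; $\mathrm{vc}(G)$ is its vertex cover number. A $k$-ASHG is an ASHG together with $k\in\mathbb{N}$; it admits an IR coalition structure if there is one with exactly $k$ coalitions. An ASHG-SCC (ASHG with size-constrained coalitions) is an ASHG together with $k\in\mathbb{N}$ and bounds $\mathrm{lb}(j)\le \mathrm{ub}(j)$ in $\mathbb{N}$ for $1\le j\le k$; it admits an IR coalition structure if there is one, $\pi=(\pi_1,\dots,\pi_k)$, with exactly $k$ coalitions and $\mathrm{lb}(j)\le|\pi_j|\le\mathrm{ub}(j)$ for all $j$. Instances are encoded as words that contain the full matrix $(v_i(j))_{i,j}$ with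 all entries in unary, and $n$, $k$, $\mathrm{lb}(j)$, $\mathrm{ub}(j)$ in binary. Running time is the number of steps of a random-access machine (unit cost per instruction; arithmetic by addition and truncated subtraction only) that is given the input word one letter per memory cell. Theorem. There is an algorithm that decides whether a given $k$-ASHG admits an IR coalition structure, and there is an algorithm that decides whether a given ASHG-SCC admits an IR coalition structure. Each of the two algorithms satisfies both of the following time bounds. (1) On every instance it runs in time $N^{O(\max\{1,\mathrm{vc}(G)\})}$, where $N$ is the length of the input word. (2) For every $d$, on all instances with $n\ge 2$ agents in which $|v_i(j)|\le n^d$ for all $i,j$, $k\le n^d$, and (for ASHG-SCC) $\mathrm{ub}(j)\le n^d$ for all $j$, it runs in time $n^{O(\max\{1,\mathrm{vc}(G)\})}$, where the constant hidden in $O(\cdot)$ depends only on $d$. -/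

import Mathlib

/-! ### Random-access machine with a step count -/

namespace RAM

/-- A configuration: registers holding natural numbers, together with unbounded arrays of natural
numbers. A program mentions only finitely many registers and arrays. -/
structure Config where
  reg : ℕ → ℕ
  arr : ℕ → ℕ → ℕ

namespace Config

/-- Write `m` into register `x`. -/
def setReg (s : Config) (x m : ℕ) : Config :=
  { s with reg := Function.update s.reg x m }

/-- Write `m` into the cell with index `i` of array `a`. -/
def setArr (s : Config) (a i m : ℕ) : Config :=
  { s with arr := Function.update s.arr a (Function.update (s.arr a) i m) }

end Config

/-- Programs. The arithmetic is addition and truncated subtraction only (no multiplication), so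
that counting one step per instruction is polynomially equivalent to Turing machine time. -/
inductive Prog : Type
  /-- do nothing -/
  | skip : Prog
  /-- `x := m`, where `m` is a constant of the program -/
  | const (x m : ℕ) : Prog
  /-- `x := y + z` -/
  | add (x y z : ℕ) : Prog
  /-- `x := max (y - z) 0` -/
  | sub (x y z : ℕ) : Prog
  /-- `x := a[y]` -/
  | load (x a y : ℕ) : Prog
  /-- `a[x] := y` -/
  | store (a x y : ℕ) : Prog
  /-- first `p`, then `q` -/
  | seq (p q : Prog) : Prog
  /-- if `x ≠ 0` then `p`, else `q` -/
  | ite (x : ℕ) (p q : Prog) : Prog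
  /-- while `x ≠ 0` do `p` -/
  | while (x : ℕ) (p : Prog) : Prog

/-- `Exec p s t s'`: started in configuration `s`, the program `p` halts in configuration `s'`
after exactly `t` steps. Each elementary instruction and each evaluation of a test is one step. -/
inductive Exec : Prog → Config → ℕ → Config → Prop
  | skip (s : Config) : Exec .skip s 1 s
  | const (x m : ℕ) (s : Config) : Exec (.const x m) s 1 (s.setReg x m)
  | add (x y z : ℕ) (s : Config) : Exec (.add x y z) s 1 (s.setReg x (s.reg y + s.reg z))
  | sub (x y z : ℕ) (s : Config) : Exec (.sub x y z) s 1 (s.setReg x (s.reg y - s.reg z))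
  | load (x a y : ℕ) (s : Config) : Exec (.load x a y) s 1 (s.setReg x (s.arr a (s.reg y)))
  | store (a x y : ℕ) (s : Config) : Exec (.store a x y) s 1 (s.setArr a (s.reg x) (s.reg y))
  | seq {p q : Prog} {s s' s'' : Config} {t t' : ℕ} (hp : Exec p s t s') (hq : Exec q s' t' s'') :
      Exec (.seq p q) s (t + t') s''
  | ite_true {x : ℕ} {p q : Prog} {s s' : Config} {t : ℕ} (hx : s.reg x ≠ 0)
      (hp : Exec p s t s') : Exec (.ite x p q) s (t + 1) s'
  | ite_false {x : ℕ} {p q : Prog} {s s' : Config} {t : ℕ} (hx : s.reg x = 0)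
      (hq : Exec q s t s') : Exec (.ite x p q) s (t + 1) s'
  | while_true {x : ℕ} {p : Prog} {s s' s'' : Config} {t t' : ℕ} (hx : s.reg x ≠ 0)
      (hp : Exec p s t s') (hw : Exec (.while x p) s' t' s'') :
      Exec (.while x p) s (t + 1 + t') s''
  | while_false {x : ℕ} {p : Prog} {s : Config} (hx : s.reg x = 0) : Exec (.while x p) s 1 s

/-- The machine is deterministic: the halting configuration and the number of steps are determined
by the program and the initial configuration. -/
theorem Exec.unique {p : Prog} {s s₁ s₂ : Config} {t₁ t₂ : ℕ}
    (h₁ : Exec p s t₁ s₁) (h₂ : Exec p s t₂ s₂) : t₁ = t₂ ∧ s₁ = s₂ := by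
  induction h₁ generalizing t₂ s₂ with
  | skip => cases h₂; exact ⟨rfl, rfl⟩
  | const => cases h₂; exact ⟨rfl, rfl⟩
  | add => cases h₂; exact ⟨rfl, rfl⟩
  | sub => cases h₂; exact ⟨rfl, rfl⟩
  | load => cases h₂; exact ⟨rfl, rfl⟩
  | store => cases h₂; exact ⟨rfl, rfl⟩
  | seq _ _ ihp ihq =>
    cases h₂ with
    | seq hp' hq' =>
      obtain ⟨rfl, rfl⟩ := ihp hp'
      obtain ⟨rfl, rfl⟩ := ihq hq'
      exact ⟨rfl, rfl⟩
  | ite_true hx _ ih =>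
    cases h₂ with
    | ite_true _ hp' =>
      obtain ⟨rfl, rfl⟩ := ih hp'
      exact ⟨rfl, rfl⟩
    | ite_false hx' _ => exact absurd hx' hx
  | ite_false hx _ ih =>
    cases h₂ with
    | ite_true hx' _ => exact absurd hx hx'
    | ite_false _ hq' =>
      obtain ⟨rfl, rfl⟩ := ih hq'
      exact ⟨rfl, rfl⟩
  | while_true hx _ _ ihp ihw =>
    cases h₂ with
    | while_true _ hp' hw' =>
      obtain ⟨rfl, rfl⟩ := ihp hp'
      obtain ⟨rfl, rfl⟩ := ihw hw'
      exact ⟨rfl, rfl⟩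
    | while_false hx' => exact absurd hx' hx
  | while_false hx =>
    cases h₂ with
    | while_true hx' _ _ => exact absurd hx hx'
    | while_false _ => exact ⟨rfl, rfl⟩

/-- The initial configuration on an input word over the alphabet `{0, 1, 2}`: register `0` holds
the length of the word, array `0` holds its letters, one per cell, and everything else is `0`. -/
def start (w : List (Fin 3)) : Config where
  reg := Function.update (fun _ => 0) 0 w.length
  arr := Function.update (fun _ _ => 0) 0 (fun i => (w[i]?.getD 0 : Fin 3).val)

open Classical in
/-- On input `w`, the program halts within `T` steps with the correct answer to the yes/no question
`Q`: register `0` finally holds `1` if `Q` holds, and `0` if not. -/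
def AnswersWithin (p : Prog) (w : List (Fin 3)) (Q : Prop) (T : ℕ) : Prop :=
  ∃ t s, Exec p (start w) t s ∧ t ≤ T ∧ s.reg 0 = if Q then 1 else 0

end RAM

/-! ### Encodings of numbers as words -/

/-- Binary encoding of a natural number, least significant bit first, ended by the letter `2`. -/
def encodeBinary (m : ℕ) : List (Fin 3) :=
  m.bits.map (fun b => if b then 1 else 0) ++ [2]

/-- Unary encoding of an integer: the letter `0` if it is negative, then as many letters `1` as its
absolute value, ended by the letter `2`. -/
def encodeUnary (z : ℤ) : List (Fin 3) :=
  (if z < 0 then [0] else []) ++ List.replicate z.natAbs 1 ++ [2]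

/-! ### Additively separable hedonic games -/

/-- An additively separable valuation profile of the agents `0, …, n - 1`: agent `i` has the integer
value `val i j` for agent `j`. The values need not be symmetric. -/
structure ASHG where
  n : ℕ
  val : Fin n → Fin n → ℤ
  val_self : ∀ i, val i i = 0

namespace ASHG

/-- The value of agent `i` for a coalition `C` (that contains `i`). -/
def utility (Γ : ASHG) (i : Fin Γ.n) (C : Finset (Fin Γ.n)) : ℤ :=
  ∑ j ∈ C, Γ.val i j

/-- A coalition structure: a partition of the set of all agents into nonempty coalitions. -/
abbrev CoalitionStructure (Γ : ASHG) : Type :=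
  Finpartition (Finset.univ : Finset (Fin Γ.n))

/-- Individual rationality: no agent prefers being alone to its coalition `P.part i`. -/
def IsIR (Γ : ASHG) (P : Γ.CoalitionStructure) : Prop :=
  ∀ i, Γ.utility i {i} ≤ Γ.utility i (P.part i)

/-- The preference graph, without weights and directions: `i` and `j` are adjacent if one of them
has a nonzero value for the other. -/
def graph (Γ : ASHG) : SimpleGraph (Fin Γ.n) :=
  SimpleGraph.fromRel fun i j => Γ.val i j ≠ 0

/-- The vertex cover number of the preference graph, as a natural number. -/
noncomputable def vc (Γ : ASHG) : ℕ :=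
  Γ.graph.vertexCoverNum.toNat

theorem coe_vc (Γ : ASHG) : (Γ.vc : ℕ∞) = Γ.graph.vertexCoverNum :=
  ENat.natCast_toNat SimpleGraph.vertexCoverNum_ne_top_of_finite

/-- The matrix of all values in unary, row by row. -/
def encodeVal (Γ : ASHG) : List (Fin 3) :=
  (List.ofFn fun i => (List.ofFn fun j => encodeUnary (Γ.val i j)).flatten).flatten

end ASHG

/-- A `k`-ASHG: exactly `k` coalitions are to be formed. -/
structure KASHG extends ASHG where
  k : ℕ

namespace KASHG

/-- There is an individually rational coalition structure with exactly `k` coalitions. -/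
def AdmitsIR (Γ : KASHG) : Prop :=
  ∃ P : Γ.CoalitionStructure, P.parts.card = Γ.k ∧ Γ.IsIR P

/-- The input word: `n` and `k` in binary, the values in unary. -/
def encode (Γ : KASHG) : List (Fin 3) :=
  encodeBinary Γ.n ++ encodeBinary Γ.k ++ Γ.encodeVal

end KASHG

/-- An ASHG with size-constrained coalitions: `k` coalitions are to be formed, the `j`-th of which
has between `lb j` and `ub j` members. -/
structure ASHGSCC extends ASHG where
  k : ℕ
  lb : Fin k → ℕ
  ub : Fin k → ℕ
  lb_le_ub : ∀ j, lb j ≤ ub j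

namespace ASHGSCC

/-- There is an individually rational coalition structure `(π₁, …, π_k)`, that is, a partition with
an enumeration `e` of its parts, which obeys the size constraints. -/
def AdmitsIR (Γ : ASHGSCC) : Prop :=
  ∃ (P : Γ.CoalitionStructure) (e : Fin Γ.k ≃ P.parts),
    (∀ j, Γ.lb j ≤ (e j).val.card ∧ (e j).val.card ≤ Γ.ub j) ∧ Γ.IsIR P

/-- The input word: `n`, `k`, then all pairs `lb j`, `ub j` in binary, and the values in unary. -/
def encode (Γ : ASHGSCC) : List (Fin 3) :=
  encodeBinary Γ.n ++ encodeBinary Γ.k ++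
    (List.ofFn fun j => encodeBinary (Γ.lb j) ++ encodeBinary (Γ.ub j)).flatten ++ Γ.encodeVal

end ASHGSCC

/-! Let `U` be a vertex cover of size `c`. An agent outside `U` has nonzero values only for members
of `U`. Once `U` and the coalitions (labels) of its members are guessed, the utility of an outside
agent depends on its own label alone, so its admissible labels can be tested agent by agent; a label
not used by `U` always gives it utility 0. What has to be controlled globally are `2c + 1` numbers:
the utility of each member of `U`, the size of each coalition that meets `U`, and the total number
of agents in the remaining coalitions. The latter coalitions can be filled arbitrarily, and every
total between the sum of their lower bounds and the sum of their upper bounds can be distributed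
(`exists_labelling_of_sum_le`). This reduction is `feasible_iff`.

A dynamic program over the agents adds up these `2c + 1` numbers. Values are unary, so all of them,
with utilities shifted to be nonnegative, are at most `2 N * N` and fit into digits of base `N ^ 4`.
A guess takes `2c` digits, the number of treated agents one, a state `2c + 1`; the table is
therefore indexed by numbers with `4c + 2` digits, which lie below `B = N ^ (16 (c + 1) + 1)`. Its
meaning is `table_iff`, and `answer_iff` reads off the answer.

For the running time no explicit program is analysed. `Comp` and `CompP` are closed under
arithmetic, case distinction, sums and quantifiers bounded by `B`, each at a cost polynomial in `B`,
and every ingredient of the algorithm is such an expression. Since the cover number is not given,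
the machine tries `c = 0, 1, ...`, multiplying `B` by `N ^ 16` each time, until a cover of size `c`
shows up; then it fills the table (`exists_answersWithin`). This takes time polynomial in `N ^ (16
(vc + 1) + 1)`, which is bound (1). Bound (2) follows because the word length is polynomial in `n`
under its hypotheses (`length_encode_le`).

Both problems share one solver: a `k`-ASHG is the case of size bounds 1 and `n`
(`KASHG.admitsIR_iff`), and `ASHG.feasible_iff_exists_structure` passes between coalition structures
and labellings. -/

open Finset

namespace RAM

/-! ### Functions computable in time polynomial in a loop bound -/

/-- The data that programs work on: the length `N` of the input, the current loop bound `B`, the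
current parameter `c`, the input word `w` and one table `T`. -/
structure Env where
  N : ℕ
  B : ℕ
  c : ℕ
  w : ℕ → ℕ
  T : ℕ → ℕ

/-- The environment stored in registers `0`, `1`, `2` and arrays `0`, `1`. -/
def Config.env (s : Config) : Env := ⟨s.reg 0, s.reg 1, s.reg 2, s.arr 0, s.arr 1⟩

theorem Config.env_eq {s s' : Config} {b : ℕ} (hb : 3 ≤ b) (ha : s'.arr = s.arr)
    (hr : ∀ x < b, s'.reg x = s.reg x) : s'.env = s.env := by
  simp [Config.env, ha, hr 0 (by omega), hr 1 (by omega), hr 2 (by omega)]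

/-- A function of the environment and of `d` further variables is `Comp` if there is a program that
computes it in time polynomial in `B`, for every placement `ρ` of the variables below the
register `b` that receives the value; the registers from `b` on serve as work space. -/
def Comp {d : ℕ} (f : Env → (Fin d → ℕ) → ℕ) : Prop :=
  ∃ (p : (Fin d → ℕ) → ℕ → Prog) (P : Polynomial ℕ), ∀ (ρ : Fin d → ℕ) (b : ℕ), 3 ≤ b →
    (∀ i, ρ i < b) → ∀ s : Config, ∃ t s', Exec (p ρ b) s t s' ∧ t ≤ P.eval (s.reg 1) ∧
      s'.arr = s.arr ∧ (∀ x < b, s'.reg x = s.reg x) ∧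
      s'.reg b = f s.env (fun i => s.reg (ρ i))

variable {d : ℕ} {f g h : Env → (Fin d → ℕ) → ℕ}

@[simp] theorem setReg_reg (s : Config) (x m y : ℕ) :
    (s.setReg x m).reg y = if y = x then m else s.reg y := by
  simp [Config.setReg, Function.update_apply]

@[simp] theorem setReg_arr (s : Config) (x m : ℕ) : (s.setReg x m).arr = s.arr := rfl

theorem Comp.const (m : ℕ) : Comp (d := d) fun _ _ => m :=
  ⟨fun _ b => .const b m, 1, fun ρ b _ _ s => ⟨1, _, .const b m s, by simp, rfl,
    fun x hx => by simp [hx.ne], by simp⟩⟩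

theorem comp_of_reg {r : (Fin d → ℕ) → ℕ} (hr : ∀ ρ b, 3 ≤ b → (∀ i, ρ i < b) → r ρ < b)
    (hf : ∀ s : Config, ∀ ρ, f s.env (fun i => s.reg (ρ i)) = s.reg (r ρ)) : Comp f := by
  -- There is no copy instruction; the target is cleared and the source added to it.
  refine ⟨fun ρ b => .seq (.const b 0) (.add b b (r ρ)), 2, fun ρ b hb hρ s =>
    ⟨1 + 1, _, .seq (.const _ _ _) (.add _ _ _ _), by simp, rfl, fun x hx => ?_, ?_⟩⟩
  · simp [hx.ne]
  · simp [hf, (hr ρ b hb hρ).ne]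

theorem Comp.var (i : Fin d) : Comp fun _ v => v i :=
  comp_of_reg (r := fun ρ => ρ i) (fun _ _ _ h => h i) fun _ _ => rfl

theorem Comp.N : Comp (d := d) fun e _ => e.N :=
  comp_of_reg (r := fun _ => 0) (fun _ _ _ _ => by omega) fun _ _ => rfl

theorem Comp.B : Comp (d := d) fun e _ => e.B :=
  comp_of_reg (r := fun _ => 1) (fun _ _ _ _ => by omega) fun _ _ => rfl

theorem Comp.c : Comp (d := d) fun e _ => e.c :=
  comp_of_reg (r := fun _ => 2) (fun _ _ _ _ => by omega) fun _ _ => rfl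

/-- The bound variable of a sum or quantifier is appended as the last variable; this lemma moves an
outer expression under such a binder. -/
theorem Comp.weaken (hf : Comp f) :
    Comp fun e (v : Fin (d + 1) → ℕ) => f e fun i => v i.castSucc := by
  obtain ⟨p, P, hp⟩ := hf
  exact ⟨fun ρ b => p (fun i => ρ i.castSucc) b, P,
    fun ρ b hb hρ s => hp (fun i => ρ i.castSucc) b hb (fun i => hρ _) s⟩

theorem Comp.load_aux {a : ℕ} (hf : Comp f) {F : Env → ℕ → ℕ}
    (hF : ∀ s : Config, F s.env = s.arr a) : Comp fun e v => F e (f e v) := by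
  obtain ⟨p, P, hp⟩ := hf
  refine ⟨fun ρ b => .seq (p ρ b) (.load b a b), P + 1, fun ρ b hb hρ s => ?_⟩
  obtain ⟨t, s', h1, h2, h3, h4, h5⟩ := hp ρ b hb hρ s
  refine ⟨_, _, .seq h1 (.load _ _ _ _), by simpa using h2, h3, fun x hx => ?_, ?_⟩
  · simp [hx.ne, h4 x hx]
  · simp [h5, h3, hF]

theorem Comp.w (hf : Comp f) : Comp fun e v => e.w (f e v) :=
  hf.load_aux (a := 0) (F := Env.w) fun _ => rfl

theorem Comp.T (hf : Comp f) : Comp fun e v => e.T (f e v) :=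
  hf.load_aux (a := 1) (F := Env.T) fun _ => rfl

theorem Comp.bin_aux (hf : Comp f) (hg : Comp g) {op : ℕ → ℕ → ℕ} {I : ℕ → ℕ → ℕ → Prog}
    (hI : ∀ x y z s, Exec (I x y z) s 1 (s.setReg x (op (s.reg y) (s.reg z)))) :
    Comp fun e v => op (f e v) (g e v) := by
  obtain ⟨p, P, hp⟩ := hf
  obtain ⟨q, Q, hq⟩ := hg
  -- The second operand is computed with work space from `b + 1` on, so the first one survives in
  -- `b`.
  refine ⟨fun ρ b => .seq (p ρ b) (.seq (q ρ (b + 1)) (I b b (b + 1))), P + (Q + 1),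
    fun ρ b hb hρ s => ?_⟩
  obtain ⟨t, s', h1, h2, h3, h4, h5⟩ := hp ρ b hb hρ s
  obtain ⟨t', s'', k1, k2, k3, k4, k5⟩ :=
    hq ρ (b + 1) (by omega) (fun i => (hρ i).trans (by omega)) s'
  refine ⟨_, _, .seq h1 (.seq k1 (hI _ _ _ _)), ?_, ?_, fun x hx => ?_, ?_⟩
  · rw [h4 1 (by omega)] at k2
    simp only [Polynomial.eval_add, Polynomial.eval_one]
    omega
  · simp [h3, k3]
  · simp [hx.ne, k4 x (by omega), h4 x hx]
  · have : s'.env = s.env := Config.env_eq hb h3 h4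
    simp [k5, k4 b (by omega), h5, this, fun i => h4 _ (hρ i)]

theorem Comp.add (hf : Comp f) (hg : Comp g) : Comp fun e v => f e v + g e v :=
  hf.bin_aux hg fun _ _ _ _ => .add _ _ _ _

theorem Comp.sub (hf : Comp f) (hg : Comp g) : Comp fun e v => f e v - g e v :=
  hf.bin_aux hg fun _ _ _ _ => .sub _ _ _ _

theorem Comp.ite_ne (hf : Comp f) (hg : Comp g) (hh : Comp h) :
    Comp fun e v => if f e v ≠ 0 then g e v else h e v := by
  obtain ⟨p, P, hp⟩ := hf
  obtain ⟨q, Q, hq⟩ := hg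
  obtain ⟨r, R, hr⟩ := hh
  -- A branch may overwrite the tested register `b`: it depends only on arrays and on registers
  -- below `b`.
  refine ⟨fun ρ b => .seq (p ρ b) (.ite b (q ρ b) (r ρ b)), P + (Q + R + 1),
    fun ρ b hb hρ s => ?_⟩
  obtain ⟨t, s', h1, h2, h3, h4, h5⟩ := hp ρ b hb hρ s
  have he : s'.env = s.env := Config.env_eq hb h3 h4
  by_cases hz : s'.reg b = 0
  · obtain ⟨t', s'', k1, k2, k3, k4, k5⟩ := hr ρ b hb hρ s'
    refine ⟨_, _, .seq h1 (.ite_false hz k1), ?_, k3.trans h3,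
      fun x hx => (k4 x hx).trans (h4 x hx), ?_⟩
    · rw [h4 1 (by omega)] at k2
      simp only [Polynomial.eval_add, Polynomial.eval_one]
      omega
    · rw [h5] at hz
      simp [k5, hz, he, fun i => h4 _ (hρ i)]
  · obtain ⟨t', s'', k1, k2, k3, k4, k5⟩ := hq ρ b hb hρ s'
    refine ⟨_, _, .seq h1 (.ite_true hz k1), ?_, k3.trans h3,
      fun x hx => (k4 x hx).trans (h4 x hx), ?_⟩
    · rw [h4 1 (by omega)] at k2
      simp only [Polynomial.eval_add, Polynomial.eval_one]
      omega
    · rw [h5] at hz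
      simp [k5, hz, he, fun i => h4 _ (hρ i)]

/-- A loop that runs `B` times. -/
theorem Comp.iter {F : Env → (Fin d → ℕ) → ℕ → ℕ → ℕ} (hf : Comp f)
    (hF : Comp fun e (v : Fin (d + 1 + 1) → ℕ) =>
      F e (fun i => v i.castSucc.castSucc) (v (Fin.last d).castSucc) (v (Fin.last (d + 1)))) :
    Comp fun e v => Nat.rec (f e v) (fun i r => F e v i r) e.B := by
  obtain ⟨p, P, hp⟩ := hf
  obtain ⟨q, Q, hq⟩ := hF
  -- Register `b` holds the accumulated value, `b + 1` the loop counter, `b + 2` the number of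
  -- rounds left; the loop body computes from `b + 3` on.
  let ρ' (ρ : Fin d → ℕ) (b : ℕ) : Fin (d + 1 + 1) → ℕ :=
    Fin.snoc (α := fun _ => ℕ) (Fin.snoc (α := fun _ => ℕ) ρ (b + 1)) b
  let body (ρ : Fin d → ℕ) (b : ℕ) : Prog :=
    .seq (q (ρ' ρ b) (b + 3)) (.seq (.const b 0) (.seq (.add b b (b + 3))
      (.seq (.const (b + 3) 1) (.seq (.add (b + 1) (b + 1) (b + 3)) (.sub (b + 2) 1 (b + 1))))))
  refine ⟨fun ρ b => .seq (p ρ b) (.seq (.const (b + 1) 0) (.seq (.sub (b + 2) 1 (b + 1))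
    (.while (b + 2) (body ρ b)))), P + 2 + (Polynomial.X * (Q + 6) + 1), fun ρ b hb hρ s => ?_⟩
  have loop : ∀ (m j : ℕ) (s' : Config), j + m = s.reg 1 → s'.arr = s.arr →
      (∀ x < b, s'.reg x = s.reg x) → s'.reg (b + 1) = j → s'.reg (b + 2) = m →
      s'.reg b = Nat.rec (f s.env fun i => s.reg (ρ i))
        (fun i r => F s.env (fun i => s.reg (ρ i)) i r) j →
      ∃ t s'', Exec (.while (b + 2) (body ρ b)) s' t s'' ∧ t ≤ m * (Q.eval (s.reg 1) + 6) + 1 ∧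
        s''.arr = s.arr ∧ (∀ x < b, s''.reg x = s.reg x) ∧
        s''.reg b = Nat.rec (f s.env fun i => s.reg (ρ i))
          (fun i r => F s.env (fun i => s.reg (ρ i)) i r) (s.reg 1) := by
    intro m
    induction m with
    | zero =>
      intro j s' hj ha hr h1 h2 h0
      obtain rfl : j = s.reg 1 := by omega
      exact ⟨1, s', .while_false h2, by simp, ha, hr, h0⟩
    | succ m ih =>
      intro j s' hj ha hr h1 h2 h0
      have hρ' : ∀ i, ρ' ρ b i < b + 3 := by
        intro i
        refine Fin.lastCases ?_ (fun i => Fin.lastCases ?_ (fun i => ?_) i) i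
        · simp [ρ']
        · simp [ρ']
        · have := hρ i
          simp only [ρ', Fin.snoc_castSucc]
          omega
      obtain ⟨t, s'', k1, k2, k3, k4, k5⟩ := hq (ρ' ρ b) (b + 3) (by omega) hρ' s'
      have he : s'.env = s.env := Config.env_eq hb ha hr
      have hv : s''.reg (b + 3) = F s.env (fun i => s.reg (ρ i)) j (s'.reg b) := by
        rw [k5, he]
        simp [ρ', h1, fun i => hr _ (hρ i)]
      have hB : s''.reg 1 = s.reg 1 := by rw [k4 1 (by omega), hr 1 (by omega)]
      obtain ⟨s4, hs4⟩ : ∃ s4, s4 = ((((s''.setReg b 0).setReg b (s''.reg (b + 3))).setReg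
        (b + 3) 1).setReg (b + 1) (j + 1)).setReg (b + 2) (s.reg 1 - (j + 1)) := ⟨_, rfl⟩
      have hex : Exec (body ρ b) s' (t + (1 + (1 + (1 + (1 + 1))))) s4 := by
        have h3 : 1 ≠ b + 1 := by omega
        have h4 : 1 ≠ b + 3 := by omega
        have h5 : 1 ≠ b := by omega
        have e1 := Exec.const b 0 s''
        have e2 := Exec.add b b (b + 3) (s''.setReg b 0)
        have e3 := Exec.const (b + 3) 1 ((s''.setReg b 0).setReg b (s''.reg (b + 3)))
        have e4 := Exec.add (b + 1) (b + 1) (b + 3)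
          (((s''.setReg b 0).setReg b (s''.reg (b + 3))).setReg (b + 3) 1)
        have e5 := Exec.sub (b + 2) 1 (b + 1)
          ((((s''.setReg b 0).setReg b (s''.reg (b + 3))).setReg (b + 3) 1).setReg (b + 1) (j + 1))
        simp only [setReg_reg, h3, h4, h5, if_false, if_true, hB, k4 (b + 1) (by omega), h1,
          show b + 3 ≠ b by omega, show b + 1 ≠ b by omega, show b + 1 ≠ b + 3 by omega,
          zero_add] at e2 e4 e5
        rw [hs4]
        exact .seq k1 (.seq e1 (.seq e2 (.seq e3 (.seq e4 e5))))
      obtain ⟨t', s3, l1, l2, l3, l4, l5⟩ := ih (j + 1) s4 (by omega) (by simp [hs4, k3, ha])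
        (fun x hx => by
          have h1 : x ≠ b + 2 := by omega
          have h2 : x ≠ b + 1 := by omega
          have h3 : x ≠ b + 3 := by omega
          have h4 : x ≠ b := by omega
          simp [hs4, h1, h2, h3, h4, k4 x (by omega), hr x hx])
        (by simp [hs4]) (by simp [hs4]; omega) (by simp [hs4, hv, h0])
      refine ⟨_, s3, .while_true (by omega) hex l1, ?_, l3, l4, l5⟩
      rw [hr 1 (by omega)] at k2
      rw [Nat.succ_mul]
      omega
  obtain ⟨t, s', h1, h2, h3, h4, h5⟩ := hp ρ b hb hρ s
  obtain ⟨t', s'', k1, k2, k3, k4, k5⟩ := loop (s.reg 1) 0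
    (((s'.setReg (b + 1) 0).setReg (b + 2) (s.reg 1))) (by omega) (by simp [h3])
    (fun x hx => by
      have h1 : x ≠ b + 2 := by omega
      have h2 : x ≠ b + 1 := by omega
      simp [h1, h2, h4 x hx])
    (by simp) (by simp) (by simp [h5])
  refine ⟨t + (1 + (1 + t')), s'', .seq h1 (.seq (.const _ _ _) (.seq ?_ k1)), ?_, k3, k4, ?_⟩
  · have h6 : 1 ≠ b + 1 := by omega
    have := Exec.sub (b + 2) 1 (b + 1) (s'.setReg (b + 1) 0)
    rw [setReg_reg, setReg_reg, if_neg h6, if_pos rfl, h4 1 (by omega)] at this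
    exact this
  · simp only [Polynomial.eval_add, Polynomial.eval_mul, Polynomial.eval_X, Polynomial.eval_one,
      Polynomial.eval_ofNat]
    omega
  · exact k5

theorem Comp.sum {F : Env → (Fin d → ℕ) → ℕ → ℕ}
    (hF : Comp fun e (v : Fin (d + 1) → ℕ) => F e (fun i => v i.castSucc) (v (Fin.last d))) :
    Comp fun e v => ∑ x ∈ range e.B, F e v x := by
  have := Comp.iter (F := fun e v i r => r + F e v i) (Comp.const (d := d) 0)
    ((Comp.var _).add hF.weaken)
  convert this using 3 with e v
  induction e.B with
  | zero => rfl
  | succ n ih => rw [sum_range_succ, ih]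

/-! ### Decidable predicates -/

open Classical in
/-- Predicates that can be decided in time polynomial in `B`. -/
def CompP (P : Env → (Fin d → ℕ) → Prop) : Prop :=
  Comp fun e v => if P e v then 1 else 0

variable {P Q : Env → (Fin d → ℕ) → Prop}

theorem CompP.congr (hP : CompP P) (h : ∀ e v, Q e v ↔ P e v) : CompP Q := by
  have : Q = P := by ext e v; exact h e v
  rwa [this]

theorem CompP.of_iff (hf : Comp f) (h : ∀ e v, P e v ↔ f e v ≠ 0) : CompP P := by
  have := hf.ite_ne (Comp.const 1) (Comp.const 0)
  unfold CompP
  convert this using 4 with e v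
  exact h e v

theorem Comp.ite {_ : ∀ e v, Decidable (P e v)} (hP : CompP P) (hf : Comp f) (hg : Comp g) :
    Comp fun e v => if P e v then f e v else g e v := by
  have := hP.ite_ne hf hg
  convert this using 4 with e v
  simp

theorem CompP.lt (hf : Comp f) (hg : Comp g) : CompP fun e v => f e v < g e v :=
  .of_iff (hg.sub hf) fun e v => by omega

theorem CompP.not (hP : CompP P) : CompP fun e v => ¬ P e v :=
  .of_iff ((Comp.const 1).sub hP) fun e v => by by_cases h : P e v <;> simp [h]

theorem CompP.and (hP : CompP P) (hQ : CompP Q) : CompP fun e v => P e v ∧ Q e v :=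
  .of_iff ((Comp.add hP hQ).sub (.const 1)) fun e v => by
    by_cases h : P e v <;> by_cases h' : Q e v <;> simp [h, h']

theorem CompP.or (hP : CompP P) (hQ : CompP Q) : CompP fun e v => P e v ∨ Q e v :=
  .of_iff (Comp.add hP hQ) fun e v => by
    by_cases h : P e v <;> by_cases h' : Q e v <;> simp [h, h']

theorem CompP.imp (hP : CompP P) (hQ : CompP Q) : CompP fun e v => P e v → Q e v :=
  (hP.not.or hQ).congr fun e v => by tauto

theorem CompP.le (hf : Comp f) (hg : Comp g) : CompP fun e v => f e v ≤ g e v :=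
  (CompP.lt hg hf).not.congr fun e v => by omega

theorem CompP.eq (hf : Comp f) (hg : Comp g) : CompP fun e v => f e v = g e v :=
  ((CompP.le hf hg).and (.le hg hf)).congr fun e v => by omega

theorem CompP.ne (hf : Comp f) (hg : Comp g) : CompP fun e v => f e v ≠ g e v :=
  (CompP.eq hf hg).not

theorem CompP.exists {R : Env → (Fin d → ℕ) → ℕ → Prop}
    (hR : CompP fun e (v : Fin (d + 1) → ℕ) => R e (fun i => v i.castSucc) (v (Fin.last d))) :
    CompP fun e v => ∃ x < e.B, R e v x := by
  classical
  exact .of_iff (Comp.sum (F := fun e v x => if R e v x then 1 else 0) hR) fun e v => by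
    simp

theorem CompP.forall {R : Env → (Fin d → ℕ) → ℕ → Prop}
    (hR : CompP fun e (v : Fin (d + 1) → ℕ) => R e (fun i => v i.castSucc) (v (Fin.last d))) :
    CompP fun e v => ∀ x < e.B, R e v x :=
  (CompP.exists (R := fun e v x => ¬ R e v x) hR.not).not.congr fun e v => by push Not; rfl

/-! ### Arithmetic -/

namespace Env

/-- Multiplication, if the first factor is at most `B`. -/
def mul (e : Env) (x y : ℕ) : ℕ := ∑ q ∈ range e.B, if q < x then y else 0

/-- Bounds by `B` matter for correctness only: the programs halt in time polynomial in `B` on all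
arguments, whatever value results. -/
theorem mul_eq {e : Env} {x y : ℕ} (hx : x ≤ e.B) : e.mul x y = x * y := by
  have : (range e.B).filter (· < x) = range x := by ext; simp; omega
  rw [mul, ← sum_filter, this]
  simp

/-- Division, if the quotient is at most `B`. -/
def div (e : Env) (x y : ℕ) : ℕ := ∑ q ∈ range e.B, if e.mul (q + 1) y ≤ x then 1 else 0

theorem div_eq {e : Env} {x y : ℕ} (hy : 0 < y) (hx : x ≤ e.B) : e.div x y = x / y := by
  have h : (range e.B).filter (fun q => e.mul (q + 1) y ≤ x) = range (x / y) := by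
    ext q
    have hd : x / y ≤ x := Nat.div_le_self _ _
    simp only [mem_filter, mem_range]
    constructor
    · rintro ⟨h1, h2⟩
      rw [mul_eq h1] at h2
      exact (Nat.le_div_iff_mul_le hy).2 h2
    · intro h1
      refine ⟨by omega, ?_⟩
      rw [mul_eq (by omega)]
      exact (Nat.le_div_iff_mul_le hy).1 h1
  rw [div, ← sum_filter, h]
  simp

/-- Powers with exponents at most `B`, of a base at most `B`. -/
def pow (e : Env) (x y : ℕ) : ℕ := Nat.rec 1 (fun i r => if i < y then e.mul x r else r) e.B

theorem pow_eq {e : Env} {x y : ℕ} (hx : x ≤ e.B) (hy : y ≤ e.B) : e.pow x y = x ^ y := by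
  have : ∀ m, (Nat.rec 1 (fun i r => if i < y then e.mul x r else r) m : ℕ) = x ^ min m y := by
    intro m
    induction m with
    | zero => simp
    | succ m ih =>
      change (if m < y then e.mul x _ else _) = _
      rw [ih, mul_eq hx]
      split_ifs with h
      · rw [min_eq_left h.le, min_eq_left (Nat.succ_le_of_lt h), pow_succ']
      · rw [min_eq_right (by omega), min_eq_right (by omega)]
  rw [pow, this, min_eq_right hy]

end Env

theorem Comp.mul (hf : Comp f) (hg : Comp g) : Comp fun e v => e.mul (f e v) (g e v) :=
  .sum (.ite (.lt (.var _) hf.weaken) hg.weaken (.const 0))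

theorem Comp.div (hf : Comp f) (hg : Comp g) : Comp fun e v => e.div (f e v) (g e v) :=
  .sum (.ite (.le (.mul (.add (.var _) (.const 1)) hg.weaken) hf.weaken) (.const 1) (.const 0))

theorem Comp.pow (hf : Comp f) (hg : Comp g) : Comp fun e v => e.pow (f e v) (g e v) :=
  .iter (F := fun e v i r => if i < g e v then e.mul (f e v) r else r) (.const 1)
    (.ite (.lt (.var _) hg.weaken.weaken) (.mul hf.weaken.weaken (.var _)) (.var _))

end RAM

namespace RAM

/-! ### A search for the parameter, followed by a table and an answer -/

theorem eval_mono (P : Polynomial ℕ) {x y : ℕ} (h : x ≤ y) : P.eval x ≤ P.eval y := by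
  rw [Polynomial.eval_eq_sum_range, Polynomial.eval_eq_sum_range]
  gcongr

/-- For `x ≥ 2` a coefficient `a` is at most `x ^ a` and a factor 2 at most `x`, so constants are
absorbed into the exponent. -/
theorem exists_eval_le_pow (P : Polynomial ℕ) : ∃ D, ∀ x, 2 ≤ x → P.eval x ≤ x ^ D := by
  induction P using Polynomial.induction_on' with
  | add p q hp hq =>
    obtain ⟨D, hD⟩ := hp
    obtain ⟨E, hE⟩ := hq
    refine ⟨D + E + 1, fun x hx => ?_⟩
    rw [Polynomial.eval_add]
    have h1 : x ^ D ≤ x ^ (D + E) := Nat.pow_le_pow_right (by omega) (by omega)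
    have h2 : x ^ E ≤ x ^ (D + E) := Nat.pow_le_pow_right (by omega) (by omega)
    calc p.eval x + q.eval x ≤ x ^ (D + E) * 2 := by linarith [hD x hx, hE x hx]
      _ ≤ x ^ (D + E + 1) := by rw [pow_succ]; gcongr
  | monomial n a =>
    refine ⟨a + n, fun x hx => ?_⟩
    rw [Polynomial.eval_monomial, pow_add]
    gcongr
    exact (Nat.lt_pow_self (by omega)).le

/-- The environment in which the parameter `c` is treated. -/
def levelEnv (w : List (Fin 3)) (c : ℕ) (T : ℕ → ℕ) : Env :=
  ⟨w.length, w.length ^ (16 * (c + 1) + 1), c, fun i => (w[i]?.getD 0).val, T⟩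

/-- Raises the loop bound to that of the next level. The result exceeds the old `B`, but each
multiplication has first factor `N ≤ B`, so it is correct and costs time polynomial in the old `B`.
-/
theorem Comp.N_pow_mul_B (k : ℕ) :
    Comp (d := 0) fun e _ => (fun x => e.mul e.N x)^[k] e.B := by
  induction k with
  | zero => exact .B
  | succ k ih =>
    simp only [Function.iterate_succ_apply']
    exact .mul .N ih

theorem Env.iterate_mul {e : Env} (h : e.N ≤ e.B) (k x : ℕ) :
    (fun x => e.mul e.N x)^[k] x = e.N ^ k * x := by
  induction k with
  | zero => simp
  | succ k ih => rw [Function.iterate_succ_apply', ih, mul_eq h, pow_succ']; ring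

/-- A program that fills the table. -/
theorem exists_fill {step : Env → ℕ → ℕ} (hstep : Comp (d := 1) fun e v => step e (v 0)) :
    ∃ (p : Prog) (P : Polynomial ℕ), ∀ s : Config, ∃ t s', Exec p s t s' ∧
      t ≤ P.eval (s.reg 1) ∧ (∀ x < 3, s'.reg x = s.reg x) ∧ s'.arr 0 = s.arr 0 ∧
      ∀ i < s.reg 1, ∃ T, (∀ j < i, T j = s'.arr 1 j) ∧
        s'.arr 1 i = step { s.env with T := T } i := by
  obtain ⟨q, Q, hq⟩ := hstep
  let body : Prog := .seq (q (fun _ => 4) 6) (.seq (.store 1 4 6)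
    (.seq (.const 6 1) (.seq (.add 4 4 6) (.sub 5 1 4))))
  refine ⟨.seq (.const 4 0) (.seq (.sub 5 1 4) (.while 5 body)),
    2 + (Polynomial.X * (Q + 5) + 1), fun s => ?_⟩
  have loop : ∀ (m j : ℕ) (s' : Config), j + m = s.reg 1 → s'.arr 0 = s.arr 0 →
      (∀ x < 3, s'.reg x = s.reg x) → s'.reg 4 = j → s'.reg 5 = m →
      (∀ i < j, ∃ T, (∀ j < i, T j = s'.arr 1 j) ∧
        s'.arr 1 i = step { s.env with T := T } i) →
      ∃ t s'', Exec (.while 5 body) s' t s'' ∧ t ≤ m * (Q.eval (s.reg 1) + 5) + 1 ∧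
        (∀ x < 3, s''.reg x = s.reg x) ∧ s''.arr 0 = s.arr 0 ∧
        ∀ i < s.reg 1, ∃ T, (∀ j < i, T j = s''.arr 1 j) ∧
          s''.arr 1 i = step { s.env with T := T } i := by
    intro m
    induction m with
    | zero =>
      intro j s' hj ha hr h1 h2 h0
      obtain rfl : j = s.reg 1 := by omega
      exact ⟨1, s', .while_false h2, by simp, hr, ha, h0⟩
    | succ m ih =>
      intro j s' hj ha hr h1 h2 h0
      obtain ⟨t, s'', k1, k2, k3, k4, k5⟩ := hq (fun _ => 4) 6 (by omega) (by omega) s'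
      have he : s'.env = { s.env with T := s'.arr 1 } := by
        simp [Config.env, ha, hr]
      have hv : s''.reg 6 = step { s.env with T := s'.arr 1 } j := by
        rw [k5, he]
        simp [h1]
      have hB : s''.reg 1 = s.reg 1 := by rw [k4 1 (by omega), hr 1 (by omega)]
      have e1 := Exec.store 1 4 6 s''
      rw [k4 4 (by omega), h1] at e1
      have e2 := Exec.const 6 1 (s''.setArr 1 j (s''.reg 6))
      have e3 := Exec.add 4 4 6 ((s''.setArr 1 j (s''.reg 6)).setReg 6 1)
      have hreg : ∀ x, (s''.setArr 1 j (s''.reg 6)).reg x = s''.reg x := fun _ => rfl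
      simp only [setReg_reg, hreg, if_true, k4 4 (by omega), h1,
        show (4 : ℕ) ≠ 6 by omega, if_false] at e3
      have e4 := Exec.sub 5 1 4
        (((s''.setArr 1 j (s''.reg 6)).setReg 6 1).setReg 4 (j + 1))
      simp only [setReg_reg, hreg, if_true, hB,
        show (1 : ℕ) ≠ 4 by omega, show (1 : ℕ) ≠ 6 by omega, if_false] at e4
      have hex := Exec.seq k1 (.seq e1 (.seq e2 (.seq e3 e4)))
      have harr : ∀ a, (s''.setArr 1 j (s''.reg 6)).arr a =
          if a = 1 then Function.update (s'.arr 1) j (s''.reg 6) else s'.arr a := by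
        intro a
        by_cases h : a = 1
        · subst h; simp [Config.setArr, k3]
        · simp [Config.setArr, h, k3]
      obtain ⟨t', s3, l1, l2, l3, l4, l5⟩ := ih (j + 1)
        ((((s''.setArr 1 j (s''.reg 6)).setReg 6 1).setReg 4 (j + 1)).setReg 5
          (s.reg 1 - (j + 1))) (by omega)
        (by simp only [setReg_arr, harr]; simpa using ha)
        (fun x hx => by
          simp only [setReg_reg, hreg, show x ≠ 5 by omega, show x ≠ 4 by omega,
            show x ≠ 6 by omega, if_false, k4 x (by omega), hr x hx])
        (by simp) (by simp; omega)
        -- The table seen in round `i` is the witness for entry `i`; later rounds write only to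
        -- larger indices.
        (fun i hi => by
          simp only [setReg_arr, harr, if_true]
          rcases Nat.lt_succ_iff_lt_or_eq.1 hi with hi | rfl
          · obtain ⟨T, hT, hT'⟩ := h0 i hi
            refine ⟨T, fun x hx => ?_, ?_⟩
            · rw [Function.update_of_ne (by omega), hT x hx]
            · rw [Function.update_of_ne (by omega), hT']
          · refine ⟨s'.arr 1, fun x hx => ?_, ?_⟩
            · rw [Function.update_of_ne (by omega)]
            · rw [Function.update_self, hv])
      refine ⟨_, s3, .while_true (by omega) hex l1, ?_, l3, l4, l5⟩
      rw [hr 1 (by omega)] at k2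
      rw [Nat.succ_mul]
      omega
  have e1 := Exec.const 4 0 s
  have e2 := Exec.sub 5 1 4 (s.setReg 4 0)
  simp only [setReg_reg, show (1 : ℕ) ≠ 4 by omega, if_false, if_true, Nat.sub_zero] at e2
  obtain ⟨t', s'', k1, k2, k3⟩ := loop (s.reg 1) 0
    ((s.setReg 4 0).setReg 5 (s.reg 1)) (by omega) (by simp)
    (fun x hx => by
      simp [show x ≠ 5 by omega, show x ≠ 4 by omega])
    (by simp) (by simp) (by simp)
  refine ⟨_, s'', .seq e1 (.seq e2 k1), ?_, k3⟩
  simp only [Polynomial.eval_add, Polynomial.eval_mul, Polynomial.eval_X, Polynomial.eval_one,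
    Polynomial.eval_ofNat]
  omega

/-- A program that increases `c` until the predicate `found` holds. -/
theorem exists_search {found : Env → Prop} (hfound : CompP (d := 0) fun e _ => found e) :
    ∃ (p : Prog) (P : Polynomial ℕ), ∀ w : List (Fin 3), 2 ≤ w.length → ∀ m ≤ w.length,
      found (levelEnv w m fun _ => 0) → ∃ t s c, Exec p (start w) t s ∧ c ≤ m ∧
        found (levelEnv w c fun _ => 0) ∧ s.env = levelEnv w c (fun _ => 0) ∧
        t ≤ P.eval (w.length ^ (16 * (m + 1) + 1)) := by
  classical
  obtain ⟨pB, PB, hB⟩ := Comp.N_pow_mul_B 16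
  obtain ⟨pF, PF, hF⟩ := hfound
  let body : Prog := .seq (pB Fin.elim0 4) (.seq (.const 1 0) (.seq (.add 1 1 4)
    (.seq (pF Fin.elim0 4) (.ite 4 (.const 3 0) (.seq (.const 4 1) (.add 2 2 4))))))
  -- Register 1 is initially 0, so the first instruction sets `B` to `N = N ^ (16 * 0 + 1)`.
  -- Register 3 is the flag that the search goes on.
  refine ⟨.seq (.add 1 0 1) (.seq (.const 3 1) (.while 3 body)),
    2 + ((Polynomial.X + 1) * (PB + PF + 6) + 2), fun w hw m hm hfm => ?_⟩
  have loop : ∀ (j c : ℕ) (s : Config), c + j = m →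
      s.env = ⟨w.length, w.length ^ (16 * c + 1), c, (levelEnv w c fun _ => 0).w, fun _ => 0⟩ →
      s.reg 3 ≠ 0 → ∃ t s' c', Exec (.while 3 body) s t s' ∧ c' ≤ m ∧
        found (levelEnv w c' fun _ => 0) ∧ s'.env = levelEnv w c' (fun _ => 0) ∧
        t ≤ (j + 1) * ((PB + PF).eval (w.length ^ (16 * (m + 1) + 1)) + 6) + 2 := by
    intro j
    induction j using Nat.strong_induction_on with
    | _ j ih =>
      intro c s hc he h3
      have hc' : c ≤ m := by omega
      obtain ⟨t, s', k1, k2, k3, k4, k5⟩ := hB Fin.elim0 4 (by omega) (by simp) s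
      have hr1 : s.reg 1 = w.length ^ (16 * c + 1) := congrArg Env.B he
      beta_reduce at k5
      rw [Env.iterate_mul (by rw [he]; exact Nat.le_self_pow (by omega) _), he] at k5
      have e1 := Exec.const 1 0 s'
      have e2 := Exec.add 1 1 4 (s'.setReg 1 0)
      simp only [setReg_reg, if_true, show (4 : ℕ) ≠ 1 by omega, if_false, zero_add, k5] at e2
      have he1 : ((s'.setReg 1 0).setReg 1 (w.length ^ 16 * w.length ^ (16 * c + 1))).env =
          levelEnv w c fun _ => 0 := by
        simp only [Config.env, Env.mk.injEq] at he
        simp only [Config.env, setReg_reg, setReg_arr, k3, he, levelEnv, k4 0 (by omega),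
          k4 2 (by omega), if_true, ← pow_add]
        simp
        ring
      obtain ⟨t', s2, l1, l2, l3, l4, l5⟩ := hF Fin.elim0 4 (by omega) (by simp)
        ((s'.setReg 1 0).setReg 1 (w.length ^ 16 * w.length ^ (16 * c + 1)))
      have hM : w.length ^ (16 * (c + 1) + 1) ≤ w.length ^ (16 * (m + 1) + 1) :=
        Nat.pow_le_pow_right (by omega) (by omega)
      have hM' : s.reg 1 ≤ w.length ^ (16 * (m + 1) + 1) := by
        rw [hr1]
        exact Nat.pow_le_pow_right (by omega) (by omega)
      have htime : t + t' ≤ (PB + PF).eval (w.length ^ (16 * (m + 1) + 1)) := by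
        rw [Polynomial.eval_add]
        refine Nat.add_le_add (k2.trans (eval_mono _ hM')) (l2.trans (eval_mono _ ?_))
        simp only [setReg_reg, if_true, ← pow_add]
        exact Nat.pow_le_pow_right (by omega) (by omega)
      have he2 : s2.env = levelEnv w c fun _ => 0 := by
        rw [← he1]
        exact Config.env_eq (b := 4) (by omega) l3 l4
      beta_reduce at l5
      rw [he1] at l5
      have hr3 : s2.reg 3 ≠ 0 := by
        rw [l4 3 (by omega)]
        simpa [k4 3 (by omega)] using h3
      by_cases hf : found (levelEnv w c fun _ => 0)
      · rw [if_pos hf] at l5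
        have hex : Exec body s _ _ := .seq k1 (.seq e1 (.seq e2
          (.seq l1 (.ite_true (by rw [l5]; exact one_ne_zero) (.const 3 0 s2)))))
        refine ⟨_, _, c, .while_true h3 hex (.while_false (by simp)), hc', hf, ?_, ?_⟩
        · rw [← he2]
          exact Config.env_eq (b := 3) le_rfl rfl fun x hx => by simp [hx.ne]
        · rw [Nat.succ_mul]
          omega
      · have hcm : c ≠ m := fun h => hf (h ▸ hfm)
        obtain ⟨j, rfl⟩ : ∃ i, j = i + 1 := ⟨j - 1, by omega⟩
        rw [if_neg hf] at l5
        have f1 := Exec.const 4 1 s2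
        have f2 := Exec.add 2 2 4 (s2.setReg 4 1)
        have hr2 : s2.reg 2 = c := congrArg Env.c he2
        simp only [setReg_reg, if_true, show (2 : ℕ) ≠ 4 by omega, if_false, hr2] at f2
        have hex : Exec body s _ _ := .seq k1 (.seq e1 (.seq e2
          (.seq l1 (.ite_false (by omega) (.seq f1 f2)))))
        obtain ⟨t3, s3, c3, m1, m2, m3, m4, m5⟩ := ih j (by omega) (c + 1)
          ((s2.setReg 4 1).setReg 2 (c + 1)) (by omega) (by
          simp only [levelEnv, Config.env, Env.mk.injEq] at he2 ⊢
          simp [he2]) (by simpa using hr3)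
        refine ⟨_, s3, c3, .while_true h3 hex m1, m2, m3, m4, ?_⟩
        rw [Nat.succ_mul]
        omega
  have e1 := Exec.add 1 0 1 (start w)
  have e2 := Exec.const 3 1 ((start w).setReg 1 (w.length + 0))
  obtain ⟨t, s, c, k1, k2, k3, k4, k5⟩ := loop m 0
    (((start w).setReg 1 (w.length + 0)).setReg 3 1) (by omega)
    (by simp only [Config.env, setReg_reg, levelEnv]; simp [start]) (by simp)
  refine ⟨_, s, c, .seq e1 (.seq e2 k1), k2, k3, k4, ?_⟩
  simp only [Polynomial.eval_add, Polynomial.eval_mul, Polynomial.eval_X, Polynomial.eval_one,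
    Polynomial.eval_ofNat] at k5 ⊢
  -- There are at most `m + 1` rounds, which is at most the last loop bound plus one; hence the
  -- factor `X + 1` of the polynomial.
  have : m ≤ w.length ^ (16 * (m + 1) + 1) := hm.trans (Nat.le_self_pow (by omega) _)
  have := Nat.mul_le_mul_right ((PB + PF).eval (w.length ^ (16 * (m + 1) + 1)) + 6)
    (Nat.add_le_add_right this 1)
  rw [Polynomial.eval_add] at this
  omega

/-- If the predicates `found`, `ans` and the function `step` are decided or computed in time
polynomial in `B`, then there is a program that looks for the least `c` with `found`, tabulates
`step` for this `c` and answers `ans`. -/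
theorem exists_answersWithin {found ans : Env → Prop} {step : Env → ℕ → ℕ}
    (hfound : CompP (d := 0) fun e _ => found e) (hans : CompP (d := 0) fun e _ => ans e)
    (hstep : Comp (d := 1) fun e v => step e (v 0)) :
    ∃ (p : Prog) (D : ℕ), ∀ w : List (Fin 3), 2 ≤ w.length → ∀ m ≤ w.length,
      found (levelEnv w m fun _ => 0) → ∃ c ≤ m, found (levelEnv w c fun _ => 0) ∧
        ∃ T : ℕ → ℕ, (∀ i < w.length ^ (16 * (c + 1) + 1), ∃ T', (∀ j < i, T' j = T j) ∧
          T i = step (levelEnv w c T') i) ∧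
        AnswersWithin p w (ans (levelEnv w c T)) (w.length ^ (D * max 1 m)) := by
  classical
  obtain ⟨p, P, hp⟩ := exists_search hfound
  obtain ⟨q, Q, hq⟩ := exists_fill hstep
  obtain ⟨r, R, hr⟩ := hans
  obtain ⟨D, hD⟩ := exists_eval_le_pow (P + Q + R + 2)
  refine ⟨.seq p (.seq q (.seq (r Fin.elim0 3) (.seq (.const 0 0) (.add 0 0 3)))), 33 * D,
    fun w hw m hm hfm => ?_⟩
  obtain ⟨t, s, c, h1, h2, h3, h4, h5⟩ := hp w hw m hm hfm
  obtain ⟨t', s', k1, k2, k3, k4, k5⟩ := hq s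
  obtain ⟨t2, s2, l1, l2, l3, l4, l5⟩ := hr Fin.elim0 3 le_rfl (by simp) s'
  have hB : s.reg 1 = w.length ^ (16 * (c + 1) + 1) := congrArg Env.B h4
  have he : s'.env = levelEnv w c (s'.arr 1) := by
    simp only [levelEnv, Config.env, Env.mk.injEq] at h4 ⊢
    simp [h4, k3, k4]
  refine ⟨c, h2, h3, s'.arr 1, fun i hi => ?_, ?_⟩
  · obtain ⟨T, hT, hT'⟩ := k5 i (hB ▸ hi)
    refine ⟨T, hT, ?_⟩
    rw [hT', h4]
    rfl
  · refine ⟨_, _, .seq h1 (.seq k1 (.seq l1 (.seq (.const _ _ _) (.add _ _ _ _)))), ?_, ?_⟩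
    · have hM : w.length ^ (16 * (c + 1) + 1) ≤ w.length ^ (16 * (m + 1) + 1) :=
        Nat.pow_le_pow_right (by omega) (by omega)
      rw [k3 1 (by omega)] at l2
      rw [hB] at k2 l2
      have h6 := k2.trans (eval_mono Q hM)
      have h7 := l2.trans (eval_mono R hM)
      have h8 := hD (w.length ^ (16 * (m + 1) + 1))
        (hw.trans (Nat.le_self_pow (by omega) _))
      rw [← pow_mul] at h8
      simp only [Polynomial.eval_add, Polynomial.eval_ofNat] at h8
      -- The constant comes from `16 m + 17 ≤ 33 max(1, m)`, which includes the case `m = 0`.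
      have h9 : w.length ^ ((16 * (m + 1) + 1) * D) ≤ w.length ^ (33 * D * max 1 m) := by
        refine Nat.pow_le_pow_right (by omega) ?_
        have : 16 * (m + 1) + 1 ≤ 33 * max 1 m := by omega
        calc _ ≤ 33 * max 1 m * D := Nat.mul_le_mul_right _ this
          _ = _ := by ring
      omega
    · simp only [setReg_reg, if_true, show (3 : ℕ) ≠ 0 by omega, if_false, zero_add, l5, he]

end RAM

namespace RAM

/-! ### The algorithm -/

namespace Env

variable (e : Env) (scc : Bool)

/-- The number base in which guesses and states are written. -/
def base : ℕ := e.mul e.N (e.mul e.N (e.mul e.N e.N))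

/-- Powers of the base. -/
def bpow (a : ℕ) : ℕ := e.pow e.base a

/-- The digit number `a` of `x`. -/
def dig (x a : ℕ) : ℕ :=
  e.div x (e.bpow a) - e.mul (e.div (e.div x (e.bpow a)) e.base) e.base

/-- The number of the token to which the position `p` of the input word belongs. -/
def tokIdx (p : ℕ) : ℕ := ∑ q ∈ range e.B, if q < p ∧ e.w q = 2 then 1 else 0

/-- The number that is encoded in binary by the token `m`. -/
def bin (m : ℕ) : ℕ := ∑ p ∈ range e.B, if e.w p = 1 ∧ e.tokIdx p = m then
  e.pow 2 (∑ q ∈ range e.B, if q < p ∧ e.tokIdx q = m then 1 else 0) else 0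

/-- The number of agents. -/
def n : ℕ := e.bin 0

/-- The number of coalitions. -/
def k : ℕ := e.bin 1

/-- The number of the first token of the matrix. -/
def offset : ℕ := bif scc then 2 + (e.k + e.k) else 2

/-- The lower bound for the size of a coalition, made positive. -/
def lb (j : ℕ) : ℕ := bif scc then 1 + (e.bin (2 + (j + j)) - 1) else 1

/-- The upper bound for the size of a coalition. -/
def ub (j : ℕ) : ℕ := bif scc then e.bin (2 + (j + j) + 1) else e.n

/-- The number of the token for an entry of the matrix. -/
def cell (i j : ℕ) : ℕ := e.offset scc + (e.mul i e.n + j)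

/-- The absolute value of an entry of the matrix. -/
def vabs (i j : ℕ) : ℕ :=
  ∑ p ∈ range e.B, if e.w p = 1 ∧ e.tokIdx p = e.cell scc i j then 1 else 0

/-- An entry of the matrix is negative. -/
noncomputable def vneg (i j : ℕ) : Prop := ∃ p < e.B, p < e.N ∧ e.w p = 0 ∧ e.tokIdx p = e.cell scc i j

open Classical in
/-- The positive part of an entry of the matrix. -/
noncomputable def vp (i j : ℕ) : ℕ := if e.vneg scc i j then 0 else e.vabs scc i j

open Classical in
/-- The negative part of an entry of the matrix. -/
noncomputable def vn (i j : ℕ) : ℕ := if e.vneg scc i j then e.vabs scc i j else 0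

/-- The member number `a` of the guessed vertex cover. -/
def cov (g a : ℕ) : ℕ := e.dig g a

/-- The guessed label of the member number `a` of the vertex cover. -/
def lab (g a : ℕ) : ℕ := e.dig g (e.c + a)

/-- The guess contains a vertex cover. -/
def IsCover (g : ℕ) : Prop :=
  (∀ a < e.B, a < e.c → e.cov g a < e.n ∧ ∀ b < e.B, b < a → e.cov g a ≠ e.cov g b) ∧
  ∀ i < e.B, i < e.n → ∀ j < e.B, j < e.n → e.vabs scc i j ≠ 0 →
    ∃ a < e.B, a < e.c ∧ (e.cov g a = i ∨ e.cov g a = j)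

/-- There is a vertex cover of size `c`. -/
def Found : Prop := ∃ g < e.B, e.IsCover scc g

/-- The label `o` is used by a member of the vertex cover. -/
def Used (g o : ℕ) : Prop := ∃ a < e.B, a < e.c ∧ e.lab g a = o

/-- The agent `t` may get the label `o`. -/
def Allowed (g t o : ℕ) : Prop :=
  o < e.k ∧ (∀ a < e.B, a < e.c → e.cov g a = t → o = e.lab g a) ∧
  ((∃ a < e.B, a < e.c ∧ e.cov g a = t) ∨
    ∑ a ∈ range e.B, (if a < e.c ∧ e.lab g a = o then e.vn scc t (e.cov g a) else 0) ≤
    ∑ a ∈ range e.B, if a < e.c ∧ e.lab g a = o then e.vp scc t (e.cov g a) else 0)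

open Classical in
/-- The contribution to the state if the agent `t` gets the label `o`. -/
noncomputable def weight (g t o : ℕ) : ℕ :=
  (∑ a ∈ range e.B, if a < e.c then
    (e.mul (if e.lab g a = o then e.N + e.vp scc (e.cov g a) t - e.vn scc (e.cov g a) t else e.N)
      (e.bpow a) + if e.lab g a = o then e.bpow (e.c + a) else 0) else 0) +
  if e.Used g o then 0 else e.bpow (e.c + e.c)

/-- The condition for the table to contain the guess `g` with the state `x` after the first `t`
agents have got labels. -/
def entry (g t x : ℕ) : Prop :=
  (t = 0 ∧ x = 0) ∨ (t ≠ 0 ∧ ∃ o < e.B, e.Allowed scc g (t - 1) o ∧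
    e.weight scc g (t - 1) o ≤ x ∧
    e.T (e.mul g (e.bpow (e.c + e.c + 2)) + e.mul (t - 1) (e.bpow (e.c + e.c + 1)) +
      (x - e.weight scc g (t - 1) o)) ≠ 0)

open Classical in
/-- The step of the dynamic program. -/
noncomputable def step (y : ℕ) : ℕ :=
  if e.entry scc (e.div y (e.bpow (e.c + e.c + 2)))
    (e.div (y - e.mul (e.div y (e.bpow (e.c + e.c + 2))) (e.bpow (e.c + e.c + 2)))
      (e.bpow (e.c + e.c + 1)))
    (y - e.mul (e.div y (e.bpow (e.c + e.c + 1))) (e.bpow (e.c + e.c + 1))) then 1 else 0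

open Classical in
/-- The final state `x` obeys all constraints. -/
def Good (g x : ℕ) : Prop :=
  (∀ a < e.B, a < e.c → e.mul e.n e.N ≤ e.dig x a ∧
    e.lb scc (e.lab g a) ≤ e.dig x (e.c + a) ∧ e.dig x (e.c + a) ≤ e.ub scc (e.lab g a)) ∧
  ∑ j ∈ range e.B, (if j < e.k ∧ ¬ e.Used g j then e.lb scc j else 0) ≤ e.dig x (e.c + e.c) ∧
  e.dig x (e.c + e.c) ≤ ∑ j ∈ range e.B, if j < e.k ∧ ¬ e.Used g j then e.ub scc j else 0

/-- The answer, read off the table. -/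
def Answer : Prop :=
  e.k ≤ e.n ∧ (∀ j < e.B, j < e.k → e.lb scc j ≤ e.ub scc j) ∧
  ∃ g < e.B, g < e.bpow (e.c + e.c) ∧ e.IsCover scc g ∧
    (∀ a < e.B, a < e.c → e.lab g a < e.k) ∧
    ∃ x < e.B, x < e.bpow (e.c + e.c + 1) ∧ e.Good scc g x ∧
      e.T (e.mul g (e.bpow (e.c + e.c + 2)) + e.mul e.n (e.bpow (e.c + e.c + 1)) + x) ≠ 0

end Env

/-! ### Polynomial-time computability of the ingredients of the algorithm -/

variable {d : ℕ} {f g h : Env → (Fin d → ℕ) → ℕ} {scc : Bool}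

theorem Comp.base : Comp (d := d) fun e _ => e.base :=
  .mul .N (.mul .N (.mul .N .N))

theorem Comp.bpow (hf : Comp f) : Comp fun e v => e.bpow (f e v) :=
  .pow .base hf

theorem Comp.dig (hf : Comp f) (hg : Comp g) : Comp fun e v => e.dig (f e v) (g e v) :=
  .sub (.div hf (.bpow hg)) (.mul (.div (.div hf (.bpow hg)) .base) .base)

theorem Comp.tokIdx (hf : Comp f) : Comp fun e v => e.tokIdx (f e v) :=
  .sum (.ite (.and (.lt (.var _) hf.weaken) (.eq (.w (.var _)) (.const 2))) (.const 1) (.const 0))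

theorem Comp.bin (hf : Comp f) : Comp fun e v => e.bin (f e v) :=
  .sum (.ite (.and (.eq (.w (.var _)) (.const 1)) (.eq (.tokIdx (.var _)) hf.weaken))
    (.pow (.const 2) (.sum (.ite (.and (.lt (.var _) (.var _))
      (.eq (.tokIdx (.var _)) hf.weaken.weaken)) (.const 1) (.const 0)))) (.const 0))

theorem Comp.n : Comp (d := d) fun e _ => e.n := .bin (.const 0)

theorem Comp.k : Comp (d := d) fun e _ => e.k := .bin (.const 1)

theorem Comp.offset : Comp (d := d) fun e _ => e.offset scc := by
  cases scc
  · exact .const 2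
  · exact .add (.const 2) (.add .k .k)

theorem Comp.lb (hf : Comp f) : Comp fun e v => e.lb scc (f e v) := by
  cases scc
  · exact .const 1
  · exact .add (.const 1) (.sub (.bin (.add (.const 2) (.add hf hf))) (.const 1))

theorem Comp.ub (hf : Comp f) : Comp fun e v => e.ub scc (f e v) := by
  cases scc
  · exact .n
  · exact .bin (.add (.add (.const 2) (.add hf hf)) (.const 1))

theorem Comp.cell (hf : Comp f) (hg : Comp g) : Comp fun e v => e.cell scc (f e v) (g e v) :=
  .add .offset (.add (.mul hf .n) hg)

theorem Comp.vabs (hf : Comp f) (hg : Comp g) : Comp fun e v => e.vabs scc (f e v) (g e v) :=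
  .sum (.ite (.and (.eq (.w (.var _)) (.const 1))
    (.eq (.tokIdx (.var _)) (.cell hf.weaken hg.weaken))) (.const 1) (.const 0))

theorem CompP.vneg (hf : Comp f) (hg : Comp g) : CompP fun e v => e.vneg scc (f e v) (g e v) :=
  .exists (.and (.lt (.var _) .N) (.and (.eq (.w (.var _)) (.const 0))
    (.eq (.tokIdx (.var _)) (.cell hf.weaken hg.weaken))))

theorem Comp.vp (hf : Comp f) (hg : Comp g) : Comp fun e v => e.vp scc (f e v) (g e v) :=
  .ite (.vneg hf hg) (.const 0) (.vabs hf hg)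

theorem Comp.vn (hf : Comp f) (hg : Comp g) : Comp fun e v => e.vn scc (f e v) (g e v) :=
  .ite (.vneg hf hg) (.vabs hf hg) (.const 0)

theorem Comp.cov (hf : Comp f) (hg : Comp g) : Comp fun e v => e.cov (f e v) (g e v) :=
  .dig hf hg

theorem Comp.lab (hf : Comp f) (hg : Comp g) : Comp fun e v => e.lab (f e v) (g e v) :=
  .dig hf (.add .c hg)

theorem CompP.isCover (hf : Comp f) : CompP fun e v => e.IsCover scc (f e v) :=
  .and (.forall (.imp (.lt (.var _) .c) (.and (.lt (.cov hf.weaken (.var _)) .n)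
      (.forall (.imp (.lt (.var _) (.var _))
        (.ne (.cov hf.weaken.weaken (.var _)) (.cov hf.weaken.weaken (.var _))))))))
    (.forall (.imp (.lt (.var _) .n) (.forall (.imp (.lt (.var _) .n)
      (.imp (.ne (.vabs (.var _) (.var _)) (.const 0)) (.exists (.and (.lt (.var _) .c)
        (.or (.eq (.cov hf.weaken.weaken.weaken (.var _)) (.var _))
          (.eq (.cov hf.weaken.weaken.weaken (.var _)) (.var _))))))))))

theorem CompP.found : CompP (d := d) fun e _ => e.Found scc :=
  .exists (.isCover (.var _))

theorem CompP.used (hf : Comp f) (hg : Comp g) : CompP fun e v => e.Used (f e v) (g e v) :=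
  .exists (.and (.lt (.var _) .c) (.eq (.lab hf.weaken (.var _)) hg.weaken))

theorem CompP.allowed (hf : Comp f) (hg : Comp g) (hh : Comp h) :
    CompP fun e v => e.Allowed scc (f e v) (g e v) (h e v) :=
  .and (.lt hh .k) (.and (.forall (.imp (.lt (.var _) .c)
      (.imp (.eq (.cov hf.weaken (.var _)) hg.weaken) (.eq hh.weaken (.lab hf.weaken (.var _))))))
    (.or (.exists (.and (.lt (.var _) .c) (.eq (.cov hf.weaken (.var _)) hg.weaken)))
      (.le
        (.sum (.ite (.and (.lt (.var _) .c) (.eq (.lab hf.weaken (.var _)) hh.weaken))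
          (.vn hg.weaken (.cov hf.weaken (.var _))) (.const 0)))
        (.sum (.ite (.and (.lt (.var _) .c) (.eq (.lab hf.weaken (.var _)) hh.weaken))
          (.vp hg.weaken (.cov hf.weaken (.var _))) (.const 0))))))

theorem Comp.weight (hf : Comp f) (hg : Comp g) (hh : Comp h) :
    Comp fun e v => e.weight scc (f e v) (g e v) (h e v) :=
  .add (.sum (.ite (.lt (.var _) .c)
    (.add (.mul (.ite (.eq (.lab hf.weaken (.var _)) hh.weaken)
        (.sub (.add .N (.vp (.cov hf.weaken (.var _)) hg.weaken))
          (.vn (.cov hf.weaken (.var _)) hg.weaken)) .N) (.bpow (.var _)))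
      (.ite (.eq (.lab hf.weaken (.var _)) hh.weaken) (.bpow (.add .c (.var _))) (.const 0)))
    (.const 0))) (.ite (.used hf hh) (.const 0) (.bpow (.add .c .c)))

theorem CompP.entry (hf : Comp f) (hg : Comp g) (hh : Comp h) :
    CompP fun e v => e.entry scc (f e v) (g e v) (h e v) :=
  have hg1 := (hg.sub (.const 1)).weaken
  have hw := hf.weaken.weight (scc := scc) hg1 (.var (Fin.last d))
  .or (.and (.eq hg (.const 0)) (.eq hh (.const 0))) (.and (.ne hg (.const 0)) (.exists
    (.and (.allowed hf.weaken hg1 (.var _)) (.and (.le hw hh.weaken)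
      (.ne (.T (.add (.add (.mul hf.weaken (.bpow (.add (.add .c .c) (.const 2))))
        (.mul hg1 (.bpow (.add (.add .c .c) (.const 1))))) (.sub hh.weaken hw))) (.const 0))))))

theorem Comp.step (hf : Comp f) : Comp fun e v => e.step scc (f e v) :=
  have h1 : Comp (d := d) fun e _ => e.bpow (e.c + e.c + 1) :=
    .bpow (.add (.add .c .c) (.const 1))
  have h2 : Comp (d := d) fun e _ => e.bpow (e.c + e.c + 2) :=
    .bpow (.add (.add .c .c) (.const 2))
  .ite (.entry (.div hf h2) (.div (.sub hf (.mul (.div hf h2) h2)) h1)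
    (.sub hf (.mul (.div hf h1) h1))) (.const 1) (.const 0)

theorem CompP.good (hf : Comp f) (hg : Comp g) : CompP fun e v => e.Good scc (f e v) (g e v) :=
  have h1 : CompP fun e (v : Fin (d + 1) → ℕ) =>
      v (Fin.last d) < e.k ∧ ¬ e.Used (f e fun i => v i.castSucc) (v (Fin.last d)) :=
    .and (.lt (.var _) .k) (.not (.used hf.weaken (.var _)))
  .and (.forall (.imp (.lt (.var _) .c) (.and (.le (.mul .n .N) (.dig hg.weaken (.var _)))
    (.and (.le (.lb (.lab hf.weaken (.var _))) (.dig hg.weaken (.add .c (.var _))))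
      (.le (.dig hg.weaken (.add .c (.var _))) (.ub (.lab hf.weaken (.var _))))))))
    (.and (.le (.sum (.ite h1 (.lb (.var _)) (.const 0))) (.dig hg (.add .c .c)))
      (.le (.dig hg (.add .c .c)) (.sum (.ite h1 (.ub (.var _)) (.const 0)))))

theorem CompP.answer : CompP (d := d) fun e _ => e.Answer scc :=
  .and (.le .k .n) (.and (.forall (.imp (.lt (.var _) .k) (.le (.lb (.var _)) (.ub (.var _)))))
    (.exists (.and (.lt (.var _) (.bpow (.add .c .c))) (.and (.isCover (.var _))
      (.and (.forall (.imp (.lt (.var _) .c) (.lt (.lab (.var _) (.var _)) .k)))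
        (.exists (.and (.lt (.var _) (.bpow (.add (.add .c .c) (.const 1))))
          (.and (.good (.var _) (.var _)) (.ne (.T (.add (.add
            (.mul (.var _) (.bpow (.add (.add .c .c) (.const 2))))
            (.mul .n (.bpow (.add (.add .c .c) (.const 1))))) (.var _))) (.const 0))))))))))

end RAM

/-! ### Labellings of the agents -/

/-- There is a labelling of `n` agents with `k` labels that obeys the bounds for the number of
agents with the same label and is individually rational. -/
def Feasible (n k : ℕ) (lb ub : ℕ → ℕ) (v : ℕ → ℕ → ℤ) : Prop :=
  ∃ f : ℕ → ℕ, (∀ i < n, f i < k) ∧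
    (∀ j < k, lb j ≤ #{i ∈ range n | f i = j} ∧ #{i ∈ range n | f i = j} ≤ ub j) ∧
    ∀ i < n, 0 ≤ ∑ i' ∈ range n, if f i = f i' then v i i' else 0

/-- Greedy distribution, one label at a time. It fills the coalitions that contain no member of the
cover. -/
theorem exists_labelling_of_sum_le {J : Finset ℕ} {lb ub : ℕ → ℕ} (S : Finset ℕ)
    (h : ∀ j ∈ J, lb j ≤ ub j) (hlb : ∑ j ∈ J, lb j ≤ #S) (hub : #S ≤ ∑ j ∈ J, ub j) :
    ∃ f : ℕ → ℕ, (∀ i ∈ S, f i ∈ J) ∧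
      ∀ j ∈ J, lb j ≤ #{i ∈ S | f i = j} ∧ #{i ∈ S | f i = j} ≤ ub j := by
  induction J using Finset.induction_on generalizing S with
  | empty =>
    obtain rfl : S = ∅ := by simpa using hub
    exact ⟨id, by simp, by simp⟩
  | insert j J hj ih =>
    rw [sum_insert hj] at hlb hub
    have hjj := h j (mem_insert_self _ _)
    have hJ : ∑ j ∈ J, lb j ≤ ∑ j ∈ J, ub j :=
      sum_le_sum fun i hi => h i (mem_insert_of_mem hi)
    -- Label `j` takes the least number of agents that meets its own lower bound and leaves no more
    -- than the other labels can hold. What is left is `#S - lb j` or the sum of the other upper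
    -- bounds, in both cases at least the sum of the other lower bounds.
    obtain ⟨S', hS', hc⟩ := exists_subset_card_eq
      (show max (lb j) (#S - ∑ j ∈ J, ub j) ≤ #S by omega)
    have hc' := card_sdiff_add_card_eq_card hS'
    obtain ⟨f, hf, hf'⟩ := ih (S \ S') (fun i hi => h i (mem_insert_of_mem hi)) (by omega)
      (by omega)
    refine ⟨fun i => if i ∈ S' then j else f i, fun i hi => ?_, fun i hi => ?_⟩
    · by_cases hi' : i ∈ S'
      · simp [hi']
      · simp [hi', hf i (by simp [hi, hi'])]
    · rcases mem_insert.1 hi with rfl | hi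
      · have : S.filter (fun x => (if x ∈ S' then i else f x) = i) = S' := by
          ext x
          simp only [mem_filter]
          constructor
          · rintro ⟨h1, h2⟩
            by_contra h3
            rw [if_neg h3] at h2
            exact hj (h2 ▸ hf x (by simp [h1, h3]))
          · intro h1
            exact ⟨hS' h1, by simp [h1]⟩
        rw [this, hc]
        omega
      · have : S.filter (fun x => (if x ∈ S' then j else f x) = i) =
            (S \ S').filter fun x => f x = i := by
          ext x
          simp only [mem_filter, mem_sdiff]
          by_cases hx : x ∈ S'
          · have : j ≠ i := fun h => hj (h ▸ hi)
            simp [hx, this]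
          · simp [hx]
        rw [this]
        exact hf' i hi

/-- The number with base-`M` digits `D` has these digits. -/
theorem sum_mul_pow_div_mod {M L : ℕ} {D : ℕ → ℕ} (hD : ∀ a < L, D a < M) :
    ∑ a ∈ range L, D a * M ^ a < M ^ L ∧
      ∀ b < L, (∑ a ∈ range L, D a * M ^ a) / M ^ b % M = D b := by
  induction L generalizing D with
  | zero => simp
  | succ L ih =>
    have hM : 0 < M := (Nat.zero_le _).trans_lt (hD 0 (by omega))
    obtain ⟨h1, h2⟩ := ih (D := fun a => D (a + 1)) fun a ha => hD _ (by omega)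
    have h3 : ∑ a ∈ range (L + 1), D a * M ^ a =
        D 0 + M * ∑ a ∈ range L, D (a + 1) * M ^ a := by
      rw [sum_range_succ', mul_sum, add_comm]
      simp only [pow_zero, mul_one, pow_succ]
      congr 1
      exact sum_congr rfl fun a _ => by ring
    have h0 := hD 0 (by omega)
    rw [h3]
    refine ⟨?_, fun b hb => ?_⟩
    · calc _ < M + M * ∑ a ∈ range L, D (a + 1) * M ^ a := by omega
        _ = M * ((∑ a ∈ range L, D (a + 1) * M ^ a) + 1) := by ring
        _ ≤ M * M ^ L := by gcongr; omega
        _ = M ^ (L + 1) := by ring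
    · rcases b with _ | b
      · simp [Nat.mod_eq_of_lt h0]
      · rw [pow_succ', ← Nat.div_div_eq_div_mul, Nat.add_mul_div_left _ _ hM,
          Nat.div_eq_of_lt h0, zero_add]
        exact h2 b (by omega)

section

variable {n k c : ℕ} {lb ub : ℕ → ℕ} {v : ℕ → ℕ → ℤ} {u : ℕ → ℕ}

/-- With a vertex cover `u`, feasibility depends on the labels `l` of the cover, on labels that are
allowed for the other agents, and on the numbers of agents with labels that are used or not used
by the cover. -/
theorem feasible_iff (hlb : ∀ j < k, 1 ≤ lb j) (hu : ∀ a < c, u a < n)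
    (hinj : ∀ a < c, ∀ b < a, u a ≠ u b)
    (hcov : ∀ i < n, ∀ j < n, v i j ≠ 0 → ∃ a < c, u a = i ∨ u a = j) :
    Feasible n k lb ub v ↔ k ≤ n ∧ (∀ j < k, lb j ≤ ub j) ∧ ∃ l : ℕ → ℕ, (∀ a < c, l a < k) ∧
      ∃ o : ℕ → ℕ, (∀ i < n, o i < k ∧ (∀ a < c, u a = i → o i = l a) ∧
        ((∃ a < c, u a = i) ∨ 0 ≤ ∑ a ∈ range c, if l a = o i then v i (u a) else 0)) ∧
      (∀ a < c, 0 ≤ ∑ i ∈ range n, if l a = o i then v (u a) i else 0) ∧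
      (∀ a < c, lb (l a) ≤ #{i ∈ range n | l a = o i} ∧
        #{i ∈ range n | l a = o i} ≤ ub (l a)) ∧
      ∑ j ∈ range k with ¬ ∃ a < c, l a = j, lb j ≤
        #{i ∈ range n | ¬ ∃ a < c, l a = o i} ∧
      #{i ∈ range n | ¬ ∃ a < c, l a = o i} ≤
        ∑ j ∈ range k with ¬ ∃ a < c, l a = j, ub j := by
  classical
  have hinj' : ∀ a ∈ range c, ∀ b ∈ range c, u a = u b → a = b := by
    intro a ha b hb h
    rw [mem_range] at ha hb
    rcases lt_trichotomy a b with h' | h' | h'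
    · exact absurd h.symm (hinj b hb a h')
    · exact h'
    · exact absurd h (hinj a ha b h')
  -- An agent outside the cover has nonzero values only for members of the cover, so its utility is
  -- a sum over the cover.
  have hsum : ∀ (f : ℕ → ℕ) (i x : ℕ), i < n → (¬ ∃ a < c, u a = i) →
      (∑ i' ∈ range n, if x = f i' then v i i' else 0) =
        ∑ a ∈ range c, if f (u a) = x then v i (u a) else 0 := by
    intro f i x hi hi'
    rw [← sum_image (f := fun y => if f y = x then v i y else 0) (g := u) (s := range c)
      (fun a ha b hb h => hinj' a ha b hb h)]
    symm
    refine sum_subset_zero_on_sdiff ?_ ?_ fun y _ => ?_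
    · intro y hy
      obtain ⟨a, ha, rfl⟩ := mem_image.1 hy
      exact mem_range.2 (hu a (mem_range.1 ha))
    · intro y hy
      simp only [mem_sdiff, mem_range, mem_image, not_exists, not_and] at hy
      have : v i y = 0 := by
        by_contra h
        obtain ⟨a, ha, h | h⟩ := hcov i hi y hy.1 h
        · exact hi' ⟨a, ha, h⟩
        · exact hy.2 a ha h
      simp [this]
    · simp [eq_comm]
  constructor
  · rintro ⟨f, hf, hs, hr⟩
    have hfib : ∀ K : Finset ℕ, K ⊆ range k →
        #{i ∈ range n | f i ∈ K} = ∑ j ∈ K, #{i ∈ range n | f i = j} := by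
      intro K hK
      rw [card_eq_sum_card_fiberwise (f := f) (s := {i ∈ range n | f i ∈ K}) (t := K)
        (fun i hi => (mem_filter.1 hi).2)]
      refine sum_congr rfl fun j hj => ?_
      congr 1
      ext i
      simp only [mem_filter]
      constructor
      · rintro ⟨⟨h1, h2⟩, h3⟩; exact ⟨h1, h3⟩
      · rintro ⟨h1, h3⟩; exact ⟨⟨h1, h3 ▸ hj⟩, h3⟩
    have hrest : #{i ∈ range n | ¬ ∃ a < c, f (u a) = f i} =
        ∑ j ∈ range k with ¬ ∃ a < c, f (u a) = j, #{i ∈ range n | f i = j} := by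
      rw [← hfib _ (filter_subset _ _)]
      congr 1
      ext i
      simp only [mem_filter, mem_range]
      constructor
      · rintro ⟨h1, h2⟩; exact ⟨h1, hf i h1, h2⟩
      · rintro ⟨h1, _, h2⟩; exact ⟨h1, h2⟩
    refine ⟨?_, fun j hj => (hs j hj).1.trans (hs j hj).2, fun a => f (u a),
      fun a ha => hf _ (hu a ha), f, fun i hi => ⟨hf i hi, fun a ha h => by subst h; rfl, ?_⟩,
      fun a ha => hr _ (hu a ha), fun a ha => ?_, ?_, ?_⟩
    -- Every label occurs because the lower bounds are positive, and the classes are disjoint.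
    · calc k = ∑ j ∈ range k, 1 := by simp
        _ ≤ ∑ j ∈ range k, #{i ∈ range n | f i = j} := sum_le_sum fun j hj =>
            (hlb j (mem_range.1 hj)).trans (hs j (mem_range.1 hj)).1
        _ = #{i ∈ range n | f i ∈ range k} := (hfib _ subset_rfl).symm
        _ ≤ #(range n) := card_filter_le _ _
        _ = n := card_range n
    · by_cases h : ∃ a < c, u a = i
      · exact Or.inl h
      · right
        rw [← hsum f i (f i) hi h]
        exact hr i hi
    · have := hs _ (hf _ (hu a ha))
      simpa only [eq_comm] using this
    · rw [hrest]
      exact sum_le_sum fun j hj => (hs j (mem_range.1 (mem_filter.1 hj).1)).1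
    · rw [hrest]
      exact sum_le_sum fun j hj => (hs j (mem_range.1 (mem_filter.1 hj).1)).2
  · rintro ⟨-, hlu, l, hl, o, ho, hua, hsz, hlo, hup⟩
    obtain ⟨f', hf', hs'⟩ := exists_labelling_of_sum_le
      {i ∈ range n | ¬ ∃ a < c, l a = o i}
      (fun j hj => hlu j (mem_range.1 (mem_filter.1 hj).1)) hlo hup
    -- Labels used by the cover are kept; agents with other labels are redistributed among the
    -- unused labels. This leaves the classes of used labels unchanged, hence also all utility
    -- conditions.
    let f : ℕ → ℕ := fun i => if ∃ a < c, l a = o i then o i else f' i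
    have hf : ∀ i, (∃ a < c, l a = o i) → f i = o i := fun i h => if_pos h
    have hf2 : ∀ i, (¬ ∃ a < c, l a = o i) → f i = f' i := fun i h => if_neg h
    have hf3 : ∀ i < n, (¬ ∃ a < c, l a = o i) → f' i < k ∧ ¬ ∃ a < c, l a = f' i := by
      intro i hi h
      have := hf' i (mem_filter.2 ⟨mem_range.2 hi, h⟩)
      simpa using this
    have hused : ∀ i < n, ∀ j, (∃ a < c, l a = j) → (f i = j ↔ o i = j) := by
      rintro i hi j hj
      by_cases h : ∃ a < c, l a = o i
      · rw [hf i h]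
      · rw [hf2 i h]
        constructor
        · intro h'
          exact absurd (h' ▸ hj) (hf3 i hi h).2
        · intro h'
          exact absurd (h' ▸ hj) h
    have hfu : ∀ a < c, f (u a) = l a := by
      intro a ha
      rw [hused _ (hu a ha) _ ⟨a, ha, rfl⟩]
      exact (ho _ (hu a ha)).2.1 a ha rfl
    have hused' : ∀ i < n, ∀ a < c, l a = f i ↔ l a = o i := fun i hi a ha => by
      rw [eq_comm, hused i hi _ ⟨a, ha, rfl⟩, eq_comm]
    refine ⟨f, fun i hi => ?_, fun j hj => ?_, fun i hi => ?_⟩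
    · by_cases h : ∃ a < c, l a = o i
      · rw [hf i h]; exact (ho i hi).1
      · rw [hf2 i h]; exact (hf3 i hi h).1
    · by_cases h : ∃ a < c, l a = j
      · obtain ⟨a, ha, rfl⟩ := h
        have : {i ∈ range n | f i = l a} = {i ∈ range n | l a = o i} := by
          refine filter_congr fun i hi => ?_
          rw [hused i (mem_range.1 hi) _ ⟨a, ha, rfl⟩, eq_comm]
        rw [this]
        exact hsz a ha
      · have : {i ∈ range n | f i = j} =
            {i ∈ {i ∈ range n | ¬ ∃ a < c, l a = o i} | f' i = j} := by
          ext i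
          simp only [mem_filter, mem_range, and_assoc]
          refine and_congr_right fun hi => ?_
          by_cases h' : ∃ a < c, l a = o i
          · have : f i ≠ j := fun h3 => h ((hf i h').symm.trans h3 ▸ h')
            simp only [this, h', not_true, false_and]
          · rw [hf2 i h']
            exact ⟨fun h3 => ⟨h', h3⟩, fun h3 => h3.2⟩
        rw [this]
        exact hs' j (mem_filter.2 ⟨mem_range.2 hj, h⟩)
    · by_cases h : ∃ a < c, u a = i
      · obtain ⟨a, ha, rfl⟩ := h
        refine (hua a ha).trans_eq (sum_congr rfl fun i hi => ?_)
        rw [hfu a ha]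
        exact if_congr (hused' i (mem_range.1 hi) a ha).symm rfl rfl
      · rw [hsum f i _ hi h]
        have h1 : ∀ a ∈ range c, (if f (u a) = f i then v i (u a) else 0) =
            if l a = o i then v i (u a) else 0 := by
          intro a ha
          rw [mem_range] at ha
          rw [hfu a ha]
          exact if_congr (hused' i hi a ha) rfl rfl
        rw [sum_congr rfl h1]
        exact (ho i hi).2.2.resolve_left h

end

/-- Programs quantify and sum over everything below `B`; this and the next two lemmas replace that
range by the intended one. -/
theorem exists_lt_and_iff {b c : ℕ} (h : c ≤ b) {P : ℕ → Prop} :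
    (∃ a < b, a < c ∧ P a) ↔ ∃ a < c, P a :=
  ⟨fun ⟨a, _, h1, h2⟩ => ⟨a, h1, h2⟩, fun ⟨a, h1, h2⟩ => ⟨a, by omega, h1, h2⟩⟩

theorem forall_lt_imp_iff {b c : ℕ} (h : c ≤ b) {P : ℕ → Prop} :
    (∀ a < b, a < c → P a) ↔ ∀ a < c, P a :=
  ⟨fun H a h1 => H a (by omega) h1, fun H a _ h1 => H a h1⟩

theorem sum_range_ite_lt {b c : ℕ} (h : c ≤ b) (F : ℕ → ℕ) :
    (∑ a ∈ range b, if a < c then F a else 0) = ∑ a ∈ range c, F a := by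
  rw [← sum_filter]
  congr 1
  ext
  simp
  omega

/-! ### Size bounds, digits and guesses -/

namespace RAM.Env

/-- The bounds that hold for the environments of the program. -/
structure Adequate (e : Env) : Prop where
  two_le : 2 ≤ e.N
  c_le : e.c ≤ e.N
  B_eq : e.B = e.N ^ (16 * (e.c + 1) + 1)

variable {e : Env} {scc : Bool}

namespace Adequate

theorem pow_le (h : e.Adequate) {m : ℕ} (hm : m ≤ 16 * (e.c + 1) + 1) : e.N ^ m ≤ e.B := by
  rw [h.B_eq]
  exact Nat.pow_le_pow_right (by have := h.two_le; omega) hm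

theorem mul_le (h : e.Adequate) : 16 * e.N ≤ e.B := by
  have h1 := h.two_le
  refine le_trans ?_ (h.pow_le (m := 5) (by omega))
  calc 16 * e.N = 2 ^ 4 * e.N := by norm_num
    _ ≤ e.N ^ 4 * e.N := by gcongr
    _ = e.N ^ 5 := by ring

theorem base_eq (h : e.Adequate) : e.base = e.N ^ 4 := by
  have := h.mul_le
  rw [base, mul_eq (by omega), mul_eq (by omega), mul_eq (by omega)]
  ring

theorem base_le (h : e.Adequate) : e.base ≤ e.B := by
  rw [h.base_eq]
  exact h.pow_le (by omega)

theorem base_pos (h : e.Adequate) : 0 < e.base := by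
  rw [h.base_eq]
  have := h.two_le
  positivity

/-- A digit of a state is a sum of at most `N` summands, each at most `2 N`; with this bound no
carries occur. -/
theorem lt_base (h : e.Adequate) {x : ℕ} (hx : x ≤ 2 * e.N * e.N) : x < e.base := by
  rw [h.base_eq]
  have h1 := h.two_le
  calc x ≤ 2 * e.N * e.N := hx
    _ ≤ e.N * e.N * e.N := by gcongr
    _ < e.N * e.N * e.N * e.N := lt_mul_of_one_lt_right (by positivity) (by omega)
    _ = e.N ^ 4 := by ring

theorem bpow_eq (h : e.Adequate) {a : ℕ} (ha : a ≤ e.B) : e.bpow a = e.base ^ a :=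
  pow_eq h.base_le ha

/-- The table index has `2c` digits for the guess, one for the number of treated agents and `2c + 1`
for the state; `(N ^ 4) ^ (4c + 2) = N ^ (16c + 8)`. -/
theorem base_pow_le (h : e.Adequate) : e.base ^ (e.c + e.c + (e.c + e.c) + 2) ≤ e.B := by
  rw [h.base_eq, ← pow_mul]
  exact h.pow_le (by omega)

theorem dig_eq (h : e.Adequate) {x a : ℕ} (hx : x ≤ e.B) (ha : a ≤ e.B) :
    e.dig x a = x / e.base ^ a % e.base := by
  have h1 : x / e.base ^ a ≤ x := Nat.div_le_self _ _
  have h2 : x / e.base ^ a / e.base ≤ x / e.base ^ a := Nat.div_le_self _ _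
  rw [dig, h.bpow_eq ha, div_eq (pow_pos h.base_pos _) hx, div_eq h.base_pos (by omega),
    mul_eq (by omega)]
  have := Nat.mod_add_div' (x / e.base ^ a) e.base
  omega

theorem dig_sum (h : e.Adequate) {L : ℕ} {D : ℕ → ℕ} (hD : ∀ a < L, D a < e.base)
    (hL : L ≤ e.c + e.c + (e.c + e.c) + 2) :
    ∑ a ∈ range L, D a * e.base ^ a < e.base ^ L ∧
      ∀ b < L, e.dig (∑ a ∈ range L, D a * e.base ^ a) b = D b := by
  obtain ⟨h1, h2⟩ := sum_mul_pow_div_mod hD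
  refine ⟨h1, fun b hb => ?_⟩
  have h3 := h.base_pow_le
  have h4 : e.base ^ L ≤ e.base ^ (e.c + e.c + (e.c + e.c) + 2) :=
    Nat.pow_le_pow_right h.base_pos hL
  have := h.mul_le
  have := h.c_le
  have := h.two_le
  rw [h.dig_eq (by omega) (by omega), h2 b hb]

theorem c_le_B (h : e.Adequate) : e.c ≤ e.B := by
  have := h.mul_le
  have := h.c_le
  omega

end Adequate

/-- An entry of the matrix. -/
noncomputable def value (e : Env) (scc : Bool) (i j : ℕ) : ℤ := e.vp scc i j - e.vn scc i j

theorem value_ne_zero {i j : ℕ} : e.value scc i j ≠ 0 ↔ e.vabs scc i j ≠ 0 := by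
  unfold value vp vn
  split_ifs <;> simp

theorem isCover_iff (h : e.Adequate) (hn : e.n ≤ e.N) {g : ℕ} : e.IsCover scc g ↔
    (∀ a < e.c, e.cov g a < e.n) ∧ (∀ a < e.c, ∀ b < a, e.cov g a ≠ e.cov g b) ∧
    ∀ i < e.n, ∀ j < e.n, e.value scc i j ≠ 0 → ∃ a < e.c, e.cov g a = i ∨ e.cov g a = j := by
  have h1 := h.c_le_B
  have h2 := h.mul_le
  have h3 : e.n ≤ e.B := by omega
  simp only [IsCover, forall_lt_imp_iff h1, forall_lt_imp_iff h3, exists_lt_and_iff h1,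
    ← value_ne_zero]
  constructor
  · rintro ⟨h4, h5⟩
    exact ⟨fun a ha => (h4 a ha).1, fun a ha b hb => (h4 a ha).2 b (by omega) hb, h5⟩
  · rintro ⟨h4, h5, h6⟩
    exact ⟨fun a ha => ⟨h4 a ha, fun b _ hb => h5 a ha b hb⟩, h6⟩

/-- Every choice of a cover and of labels is made by a guess. -/
theorem exists_guess (h : e.Adequate) {u l : ℕ → ℕ} (hu : ∀ a < e.c, u a < e.N)
    (hl : ∀ a < e.c, l a < e.N) : ∃ g < e.base ^ (e.c + e.c),
      (∀ a < e.c, e.cov g a = u a) ∧ ∀ a < e.c, e.lab g a = l a := by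
  have hN : e.N < e.base := h.lt_base (by have := h.two_le; nlinarith)
  obtain ⟨h1, h2⟩ := h.dig_sum (L := e.c + e.c)
    (D := fun a => if a < e.c then u a else l (a - e.c)) (fun a ha => by
      split_ifs with h1
      · have := hu a h1
        omega
      · have := hl (a - e.c) (by omega)
        omega) (by omega)
  refine ⟨_, h1, fun a ha => ?_, fun a ha => ?_⟩
  · rw [cov, h2 a (by omega), if_pos ha]
  · rw [lab, h2 _ (by omega), if_neg (by omega)]
    congr 1
    omega

theorem isCover_of_eq (h : e.Adequate) (hn : e.n ≤ e.N) {u : ℕ → ℕ} {g : ℕ}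
    (hg : ∀ a < e.c, e.cov g a = u a)
    (hu : ∀ a < e.c, u a < e.n) (hinj : ∀ a < e.c, ∀ b < a, u a ≠ u b)
    (hcov : ∀ i < e.n, ∀ j < e.n, e.value scc i j ≠ 0 → ∃ a < e.c, u a = i ∨ u a = j) :
    e.IsCover scc g := by
  rw [isCover_iff h hn]
  refine ⟨fun a ha => by rw [hg a ha]; exact hu a ha, fun a ha b hb => ?_, fun i hi j hj hv => ?_⟩
  · rw [hg a ha, hg b (by omega)]
    exact hinj a ha b hb
  · obtain ⟨a, ha, h'⟩ := hcov i hi j hj hv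
    exact ⟨a, ha, by rwa [hg a ha]⟩

theorem found_of_cover (h : e.Adequate) (hn : e.n ≤ e.N) {u : ℕ → ℕ} (hu : ∀ a < e.c, u a < e.n)
    (hinj : ∀ a < e.c, ∀ b < a, u a ≠ u b)
    (hcov : ∀ i < e.n, ∀ j < e.n, e.value scc i j ≠ 0 → ∃ a < e.c, u a = i ∨ u a = j) :
    e.Found scc := by
  -- The labels do not matter for being a cover; `u` serves as a filler.
  obtain ⟨g, hg, h1, h2⟩ := exists_guess h (u := u) (l := u)
    (fun a ha => (hu a ha).trans_le hn) (fun a ha => (hu a ha).trans_le hn)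
  refine ⟨g, hg.trans_le (le_trans ?_ h.base_pow_le), isCover_of_eq h hn h1 hu hinj hcov⟩
  exact Nat.pow_le_pow_right h.base_pos (by omega)

/-! ### The dynamic program -/

/-- The table has been filled by the steps of the dynamic program. -/
def Filled (e : Env) (scc : Bool) : Prop :=
  ∀ y < e.B, ∃ T', (∀ j < y, T' j = e.T j) ∧ e.T y = { e with T := T' }.step scc y

/-- Writing the index in mixed radix, `step` recovers `g`, `t`, `x` by divisions whose arguments
stay below `B`, so the machine operations agree with true arithmetic. -/
theorem step_eq (h : e.Adequate) {g t x : ℕ}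
    (hg : g < e.base ^ (e.c + e.c)) (ht : t < e.base) (hx : x < e.base ^ (e.c + e.c + 1)) :
    g * e.base ^ (e.c + e.c + 2) + t * e.base ^ (e.c + e.c + 1) + x < e.B ∧
    (e.step scc (g * e.base ^ (e.c + e.c + 2) + t * e.base ^ (e.c + e.c + 1) + x) ≠ 0 ↔
      (t = 0 ∧ x = 0) ∨ (t ≠ 0 ∧ ∃ o < e.B, e.Allowed scc g (t - 1) o ∧
        e.weight scc g (t - 1) o ≤ x ∧ e.T (g * e.base ^ (e.c + e.c + 2) +
          (t - 1) * e.base ^ (e.c + e.c + 1) + (x - e.weight scc g (t - 1) o)) ≠ 0)) := by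
  have hM := h.base_pos
  have hB := h.base_pow_le
  have hc := h.c_le
  have h2 := h.two_le
  have hm := h.mul_le
  obtain ⟨W, hW⟩ : ∃ W, W = e.base ^ (e.c + e.c + 1) := ⟨_, rfl⟩
  have hY : e.base ^ (e.c + e.c + 2) = W * e.base := by rw [hW]; ring
  have hW0 : 0 < W := hW ▸ pow_pos hM _
  have hy1 : t * W + x < W * e.base := by
    calc t * W + x < t * W + W := by rw [hW]; omega
      _ = (t + 1) * W := by ring
      _ ≤ e.base * W := Nat.mul_le_mul_right _ ht
      _ = W * e.base := mul_comm _ _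
  have hy : g * (W * e.base) + t * W + x < e.B := by
    refine lt_of_lt_of_le ?_ hB
    calc g * (W * e.base) + t * W + x < g * (W * e.base) + W * e.base := by omega
      _ = (g + 1) * (W * e.base) := by ring
      _ ≤ e.base ^ (e.c + e.c) * (W * e.base) := Nat.mul_le_mul_right _ hg
      _ = _ := by rw [hW]; ring
  have hgB : g ≤ e.B := by
    have : g * 1 ≤ g * (W * e.base) := Nat.mul_le_mul_left _ (Nat.mul_pos hW0 hM)
    omega
  have hb1 : e.bpow (e.c + e.c + 1) = W := by rw [hW]; exact h.bpow_eq (by omega)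
  have hb2 : e.bpow (e.c + e.c + 2) = W * e.base := by rw [← hY]; exact h.bpow_eq (by omega)
  have hdY : (g * (W * e.base) + t * W + x) / (W * e.base) = g := by
    rw [add_assoc, mul_comm, Nat.mul_add_div (Nat.mul_pos hW0 hM), Nat.div_eq_of_lt hy1, add_zero]
  have hdW : (t * W + x) / W = t := by
    rw [mul_comm, Nat.mul_add_div hW0, Nat.div_eq_of_lt (hW ▸ hx), add_zero]
  have hdW' : (g * (W * e.base) + t * W + x) / W = g * e.base + t := by
    rw [show g * (W * e.base) + t * W + x = W * (g * e.base + t) + x by ring,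
      Nat.mul_add_div hW0, Nat.div_eq_of_lt (hW ▸ hx), add_zero]
  have hW1 : (g * e.base + t) * W = g * (W * e.base) + t * W := by ring
  have hgt : g * e.base + t ≤ e.B := by
    have : (g * e.base + t) * 1 ≤ (g * e.base + t) * W := Nat.mul_le_mul_left _ hW0
    omega
  have ht1 : t - 1 ≤ e.B := by
    have := h.base_le
    omega
  rw [hY, ← hW]
  refine ⟨hy, ?_⟩
  have hite : ∀ (P : Prop) [Decidable P], (if P then 1 else 0 : ℕ) ≠ 0 ↔ P := by simp
  rw [step, hite, hb1, hb2, div_eq (Nat.mul_pos hW0 hM) hy.le, hdY, mul_eq hgB,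
    show g * (W * e.base) + t * W + x - g * (W * e.base) = t * W + x by omega,
    div_eq hW0 (by omega), hdW, div_eq hW0 hy.le, hdW', mul_eq hgt,
    show g * (W * e.base) + t * W + x - (g * e.base + t) * W = x by omega]
  simp only [entry, hb1, hb2, mul_eq hgB, mul_eq ht1]

theorem table_ne_zero (h : e.Adequate) (hT : e.Filled scc) {g t x : ℕ}
    (hg : g < e.base ^ (e.c + e.c)) (ht : t < e.base) (hx : x < e.base ^ (e.c + e.c + 1)) :
    e.T (g * e.base ^ (e.c + e.c + 2) + t * e.base ^ (e.c + e.c + 1) + x) ≠ 0 ↔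
      (t = 0 ∧ x = 0) ∨ (t ≠ 0 ∧ ∃ o < e.B, e.Allowed scc g (t - 1) o ∧
        e.weight scc g (t - 1) o ≤ x ∧ e.T (g * e.base ^ (e.c + e.c + 2) +
          (t - 1) * e.base ^ (e.c + e.c + 1) + (x - e.weight scc g (t - 1) o)) ≠ 0) := by
  obtain ⟨T', hT', hs⟩ := hT _ (step_eq (scc := scc) h hg ht hx).1
  have h' : ({ e with T := T' } : Env).Adequate := ⟨h.two_le, h.c_le, h.B_eq⟩
  rw [hs]
  refine (step_eq (scc := scc) h' hg ht hx).2.trans ?_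
  refine or_congr Iff.rfl (and_congr_right fun ht0 => exists_congr fun o =>
    and_congr Iff.rfl (and_congr Iff.rfl (and_congr_right fun hw => ?_)))
  change T' (g * e.base ^ (e.c + e.c + 2) + (t - 1) * e.base ^ (e.c + e.c + 1) +
    (x - e.weight scc g (t - 1) o)) ≠ 0 ↔ _
  rw [hT']
  -- The recursion reads an entry with `t - 1` in place of `t` and a state not larger than `x`, so
  -- its index is smaller; there `T'` agrees with the final table.
  have h1 : (t - 1) * e.base ^ (e.c + e.c + 1) + e.base ^ (e.c + e.c + 1) =
      t * e.base ^ (e.c + e.c + 1) := by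
    rw [← Nat.succ_mul]
    congr 1
    omega
  omega

/-- Induction on the number of treated agents. The condition `e.k ≤ e.B` guarantees that the loop
over labels meets every allowed one. -/
theorem table_iff (h : e.Adequate) (hk : e.k ≤ e.B) (hT : e.Filled scc) {g t x : ℕ}
    (hg : g < e.base ^ (e.c + e.c)) (ht : t < e.base) (hx : x < e.base ^ (e.c + e.c + 1)) :
    e.T (g * e.base ^ (e.c + e.c + 2) + t * e.base ^ (e.c + e.c + 1) + x) ≠ 0 ↔
      ∃ o : ℕ → ℕ, (∀ i < t, e.Allowed scc g i (o i)) ∧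
        x = ∑ i ∈ range t, e.weight scc g i (o i) := by
  induction t generalizing x with
  | zero =>
    rw [table_ne_zero h hT hg ht hx]
    simp
  | succ t ih =>
    rw [table_ne_zero h hT hg ht hx]
    simp only [Nat.succ_ne_zero, false_and, false_or, ne_eq, not_false_eq_true, true_and,
      Nat.add_sub_cancel]
    constructor
    · rintro ⟨o, ho, h1, h2, h3⟩
      obtain ⟨f, hf, hf'⟩ := (ih (by omega) (by omega)).1 h3
      refine ⟨Function.update f t o, fun i hi => ?_, ?_⟩
      · rcases Nat.lt_succ_iff_lt_or_eq.1 hi with hi | rfl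
        · rw [Function.update_of_ne (by omega)]
          exact hf i hi
        · rwa [Function.update_self]
      · rw [sum_range_succ, Function.update_self, sum_congr rfl fun i hi => by
          rw [Function.update_of_ne (by rw [mem_range] at hi; omega)], ← hf']
        omega
    · rintro ⟨f, hf, hf'⟩
      rw [sum_range_succ] at hf'
      have h1 := hf t (by omega)
      refine ⟨f t, h1.1.trans_le hk, h1, by omega, ?_⟩
      refine (ih (by omega) (by omega)).2 ⟨f, fun i hi => hf i (by omega), by omega⟩

end RAM.Env

/-! ### Digits of the state and correctness of the answer -/

namespace RAM.Env

variable {e : Env} {scc : Bool}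

theorem used_iff (h : e.Adequate) {g o : ℕ} : e.Used g o ↔ ∃ a < e.c, e.lab g a = o :=
  exists_lt_and_iff h.c_le_B

theorem allowed_iff (h : e.Adequate) {g t o : ℕ} : e.Allowed scc g t o ↔
    o < e.k ∧ (∀ a < e.c, e.cov g a = t → o = e.lab g a) ∧ ((∃ a < e.c, e.cov g a = t) ∨
      0 ≤ ∑ a ∈ range e.c, if e.lab g a = o then e.value scc t (e.cov g a) else 0) := by
  have hc := h.c_le_B
  have hsum : ∀ F : ℕ → ℕ, (∑ a ∈ range e.B, if a < e.c ∧ e.lab g a = o then F a else 0) =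
      ∑ a ∈ range e.c, if e.lab g a = o then F a else 0 := fun F => by
    rw [← sum_range_ite_lt hc]
    exact sum_congr rfl fun a _ => ite_and ..
  rw [Allowed, forall_lt_imp_iff hc, exists_lt_and_iff hc, hsum, hsum]
  refine and_congr_right fun _ => and_congr_right fun _ => or_congr Iff.rfl ?_
  rw [← Int.ofNat_le, ← sub_nonneg, Nat.cast_sum, Nat.cast_sum, ← sum_sub_distrib]
  refine Iff.of_eq (congrArg _ (sum_congr rfl fun a _ => ?_))
  split_ifs <;> simp [value]

open Classical in
/-- The digits of `weight`. -/
noncomputable def weightDigit (e : Env) (scc : Bool) (g t o a : ℕ) : ℕ :=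
  if a < e.c then
    if e.lab g a = o then e.N + e.vp scc (e.cov g a) t - e.vn scc (e.cov g a) t else e.N
  else if a < e.c + e.c then if e.lab g (a - e.c) = o then 1 else 0
  else if ∃ a < e.c, e.lab g a = o then 0 else 1

theorem weightDigit_of_lt {g t o a : ℕ} (ha : a < e.c) : e.weightDigit scc g t o a =
    if e.lab g a = o then e.N + e.vp scc (e.cov g a) t - e.vn scc (e.cov g a) t else e.N := by
  rw [weightDigit, if_pos ha]

theorem weightDigit_add {g t o a : ℕ} (ha : a < e.c) : e.weightDigit scc g t o (e.c + a) =
    if e.lab g a = o then 1 else 0 := by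
  rw [weightDigit, if_neg (by omega), if_pos (by omega), Nat.add_sub_cancel_left]

open Classical in
theorem weightDigit_last {g t o : ℕ} : e.weightDigit scc g t o (e.c + e.c) =
    if ∃ a < e.c, e.lab g a = o then 0 else 1 := by
  rw [weightDigit, if_neg (by omega), if_neg (by omega)]

theorem vp_add_vn {i j : ℕ} : e.vp scc i j + e.vn scc i j = e.vabs scc i j := by
  unfold vp vn
  split_ifs <;> simp

/-- Utilities can be negative, so each summand is shifted by `N`; an absolute value of at most `N`
then gives a number between 0 and `2 N`. -/
theorem weightDigit_le (hN : 1 ≤ e.N) {g t o a : ℕ}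
    (hv : a < e.c → e.vabs scc (e.cov g a) t ≤ e.N) :
    e.weightDigit scc g t o a ≤ 2 * e.N := by
  have := vp_add_vn (e := e) (scc := scc) (i := e.cov g a) (j := t)
  unfold weightDigit
  split_ifs with h1
  · have := hv h1
    omega
  all_goals omega

theorem weight_eq (h : e.Adequate) {g t o : ℕ}
    (hv : ∀ a < e.c, e.vabs scc (e.cov g a) t ≤ e.N) : e.weight scc g t o =
      ∑ a ∈ range (e.c + e.c + 1), e.weightDigit scc g t o a * e.base ^ a := by
  have h1 := h.c_le
  have h2 := h.mul_le
  have h3 := h.two_le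
  rw [weight, sum_range_ite_lt h.c_le_B, sum_add_distrib, sum_range_succ, sum_range_add]
  congr 1
  · congr 1
    · refine sum_congr rfl fun a ha => ?_
      rw [mem_range] at ha
      have h4 := weightDigit_le (o := o) (by omega) fun h => hv a h
      rw [weightDigit_of_lt ha] at h4
      rw [weightDigit_of_lt ha, mul_eq (by omega), h.bpow_eq (by omega)]
    · refine sum_congr rfl fun a ha => ?_
      rw [mem_range] at ha
      rw [weightDigit_add ha, h.bpow_eq (by omega)]
      split_ifs <;> simp
  · rw [weightDigit_last, h.bpow_eq (by omega)]
    by_cases hu : e.Used g o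
    · rw [if_pos hu, if_pos ((used_iff h).1 hu), zero_mul]
    · rw [if_neg hu, if_neg (mt (used_iff h).2 hu), one_mul]

/-- The digits of a final state. -/
theorem dig_sum_weight (h : e.Adequate) (hn : e.n ≤ e.N) {g : ℕ} (o : ℕ → ℕ)
    (hv : ∀ a < e.c, ∀ i < e.n, e.vabs scc (e.cov g a) i ≤ e.N) :
    ∑ i ∈ range e.n, e.weight scc g i (o i) < e.base ^ (e.c + e.c + 1) ∧
    (∀ a < e.c, (e.dig (∑ i ∈ range e.n, e.weight scc g i (o i)) a : ℤ) = e.n * e.N +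
      ∑ i ∈ range e.n, if e.lab g a = o i then e.value scc (e.cov g a) i else 0) ∧
    (∀ a < e.c, e.dig (∑ i ∈ range e.n, e.weight scc g i (o i)) (e.c + a) =
      #{i ∈ range e.n | e.lab g a = o i}) ∧
    e.dig (∑ i ∈ range e.n, e.weight scc g i (o i)) (e.c + e.c) =
      #{i ∈ range e.n | ¬ ∃ a < e.c, e.lab g a = o i} := by
  have h3 := h.two_le
  have hs : ∑ i ∈ range e.n, e.weight scc g i (o i) = ∑ a ∈ range (e.c + e.c + 1),
      (∑ i ∈ range e.n, e.weightDigit scc g i (o i) a) * e.base ^ a := by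
    rw [sum_congr rfl fun i hi => weight_eq h fun a ha => hv a ha i (mem_range.1 hi), sum_comm]
    exact sum_congr rfl fun a _ => (sum_mul ..).symm
  -- Weights add up digit by digit without carries.
  have hD : ∀ a < e.c + e.c + 1,
      ∑ i ∈ range e.n, e.weightDigit scc g i (o i) a < e.base := by
    intro a _
    refine h.lt_base ?_
    calc _ ≤ ∑ i ∈ range e.n, 2 * e.N := sum_le_sum fun i hi =>
          weightDigit_le (by omega) fun h => hv a h i (mem_range.1 hi)
      _ = e.n * (2 * e.N) := by simp
      _ ≤ e.N * (2 * e.N) := Nat.mul_le_mul_right _ hn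
      _ = _ := by ring
  obtain ⟨h4, h5⟩ := h.dig_sum hD (by omega)
  rw [hs]
  refine ⟨h4, fun a ha => ?_, fun a ha => ?_, ?_⟩
  · rw [h5 a (by omega), Nat.cast_sum]
    have : (e.n : ℤ) * e.N = ∑ i ∈ range e.n, (e.N : ℤ) := by simp
    rw [this, ← sum_add_distrib]
    refine sum_congr rfl fun i hi => ?_
    have h6 := hv a ha i (mem_range.1 hi)
    rw [← vp_add_vn] at h6
    rw [weightDigit_of_lt ha]
    split_ifs
    -- The subtraction is not truncated, because the negative part is at most `N`.
    · rw [value, Nat.cast_sub (by omega)]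
      push_cast
      ring
    · simp
  · rw [h5 _ (by omega), card_filter]
    exact sum_congr rfl fun i hi => weightDigit_add ha
  · rw [h5 _ (by omega), card_filter]
    refine sum_congr rfl fun i hi => ?_
    rw [weightDigit_last]
    split_ifs <;> simp_all

theorem lb_pos (j : ℕ) : 1 ≤ e.lb scc j := by
  cases scc <;> simp [lb]

/-- By `table_iff` the states found for `n` agents are the sums of weights of allowed labellings; by
`dig_sum_weight` their digits are the quantities constrained in `feasible_iff`, the utilities being
shifted by `n * N`. -/
theorem answer_iff (h : e.Adequate) (hn : e.n ≤ e.N)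
    (hv : ∀ i < e.n, ∀ j < e.n, e.vabs scc i j ≤ e.N) (hT : e.Filled scc) (hF : e.Found scc) :
    e.Answer scc ↔ Feasible e.n e.k (e.lb scc) (e.ub scc) (e.value scc) := by
  have h1 := h.c_le_B
  have h2 := h.mul_le
  have h3 := h.two_le
  have h3' := h.c_le
  have hnb : e.n < e.base := h.lt_base (by nlinarith)
  have hcB : e.base ^ (e.c + e.c) ≤ e.B :=
    le_trans (Nat.pow_le_pow_right h.base_pos (by omega)) h.base_pow_le
  have hcB' : e.base ^ (e.c + e.c + 1) ≤ e.B :=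
    le_trans (Nat.pow_le_pow_right h.base_pos (by omega)) h.base_pow_le
  have hidx : ∀ g x : ℕ, g < e.base ^ (e.c + e.c) →
      e.mul g (e.bpow (e.c + e.c + 2)) + e.mul e.n (e.bpow (e.c + e.c + 1)) + x =
      g * e.base ^ (e.c + e.c + 2) + e.n * e.base ^ (e.c + e.c + 1) + x := by
    intro g x hg
    rw [mul_eq (by omega), mul_eq (by omega), h.bpow_eq (by omega), h.bpow_eq (by omega)]
  -- `k` is given in binary and may exceed `B`; the test `e.k ≤ e.n` in `Answer` ensures that loops
  -- reach all labels.
  have hrest : ∀ (g : ℕ) (F : ℕ → ℕ), e.k ≤ e.B →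
      (∑ j ∈ range e.B, open Classical in if j < e.k ∧ ¬ e.Used g j then F j else 0) =
        ∑ j ∈ range e.k with ¬ ∃ a < e.c, e.lab g a = j, F j := by
    intro g F hk
    classical
    rw [sum_filter, ← sum_range_ite_lt hk]
    refine sum_congr rfl fun j _ => ?_
    rw [ite_and, used_iff h]
    split_ifs <;> rfl
  have hgood : ∀ (g : ℕ) (o : ℕ → ℕ), e.IsCover scc g → e.k ≤ e.B →
      (e.Good scc g (∑ i ∈ range e.n, e.weight scc g i (o i)) ↔
      (∀ a < e.c, 0 ≤ ∑ i ∈ range e.n,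
        if e.lab g a = o i then e.value scc (e.cov g a) i else 0) ∧
      (∀ a < e.c, e.lb scc (e.lab g a) ≤ #{i ∈ range e.n | e.lab g a = o i} ∧
        #{i ∈ range e.n | e.lab g a = o i} ≤ e.ub scc (e.lab g a)) ∧
      ∑ j ∈ range e.k with ¬ ∃ a < e.c, e.lab g a = j, e.lb scc j ≤
        #{i ∈ range e.n | ¬ ∃ a < e.c, e.lab g a = o i} ∧
      #{i ∈ range e.n | ¬ ∃ a < e.c, e.lab g a = o i} ≤
        ∑ j ∈ range e.k with ¬ ∃ a < e.c, e.lab g a = j, e.ub scc j) := by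
    intro g o hg hk
    rw [isCover_iff h hn] at hg
    obtain ⟨-, h5, h6, h7⟩ := dig_sum_weight h hn (scc := scc) (g := g) o
      fun a ha i hi => hv _ (hg.1 a ha) _ hi
    rw [Good, forall_lt_imp_iff h1, hrest g _ hk, hrest g _ hk, h7]
    refine (and_congr ?_ Iff.rfl).trans and_assoc
    rw [← forall₂_and]
    refine forall₂_congr fun a ha => ?_
    rw [h6 a ha, mul_eq (by omega), ← Int.ofNat_le, h5 a ha]
    push_cast
    refine and_congr ?_ Iff.rfl
    omega
  constructor
  · rintro ⟨hk, hlu, g, -, hg, hgc, hl, x, -, hx, hgx, hTx⟩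
    rw [h.bpow_eq (by omega)] at hg hx
    rw [hidx g x hg] at hTx
    obtain ⟨o, ho, rfl⟩ := (table_iff h (by omega) hT hg hnb hx).1 hTx
    rw [hgood g o hgc (by omega)] at hgx
    rw [forall_lt_imp_iff h1] at hl
    rw [forall_lt_imp_iff (by omega)] at hlu
    rw [isCover_iff h hn] at hgc
    rw [feasible_iff (fun j _ => lb_pos j) hgc.1 hgc.2.1 hgc.2.2]
    exact ⟨hk, hlu, e.lab g, hl, o, fun i hi => (allowed_iff h).1 (ho i hi), hgx⟩
  · intro hfe
    -- Only the cover of `g₀` is used: its labels are arbitrary and it may exceed `2c` digits. A new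
    -- guess combines this cover with the labels of the given solution.
    obtain ⟨g₀, -, hg₀⟩ := hF
    rw [isCover_iff h hn] at hg₀
    rw [feasible_iff (fun j _ => lb_pos j) hg₀.1 hg₀.2.1 hg₀.2.2] at hfe
    obtain ⟨hk, hlu, l, hl, o, ho, hrem⟩ := hfe
    obtain ⟨g, hg, hg1, hg2⟩ := exists_guess h (u := e.cov g₀) (l := l)
      (fun a ha => (hg₀.1 a ha).trans_le hn) (fun a ha => (hl a ha).trans_le (by omega))
    have hgc : e.IsCover scc g := isCover_of_eq h hn hg1 hg₀.1 hg₀.2.1 hg₀.2.2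
    have hgc' := (isCover_iff h hn).1 hgc
    have hex : ∀ j, (∃ a < e.c, l a = j) ↔ ∃ a < e.c, e.lab g a = j := fun j =>
      exists_congr fun a => and_congr_right fun ha => by rw [hg2 a ha]
    have hall : ∀ i < e.n, e.Allowed scc g i (o i) := by
      intro i hi
      obtain ⟨h4, h5, h6⟩ := ho i hi
      rw [allowed_iff h]
      refine ⟨h4, fun a ha => by rw [hg1 a ha, hg2 a ha]; exact h5 a ha, h6.imp ?_ fun h7 => ?_⟩
      · rintro ⟨a, ha, h7⟩
        exact ⟨a, ha, by rw [hg1 a ha, h7]⟩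
      · refine h7.trans_eq (sum_congr rfl fun a ha => ?_)
        rw [mem_range] at ha
        rw [hg1 a ha, hg2 a ha]
    obtain ⟨h5, -⟩ := dig_sum_weight h hn (scc := scc) (g := g) o
      fun a ha i hi => hv _ (hgc'.1 a ha) _ hi
    refine ⟨hk, fun j _ => hlu j, g, by omega, by rwa [h.bpow_eq (by omega)], hgc,
      fun a _ ha => by rw [hg2 a ha]; exact hl a ha, _, h5.trans_le hcB',
      by rwa [h.bpow_eq (by omega)], (hgood g o hgc (by omega)).2 ?_, ?_⟩
    · simp only [hex] at hrem
      obtain ⟨h6, h7, h8⟩ := hrem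
      refine ⟨fun a ha => ?_, fun a ha => ?_, h8⟩
      · rw [hg1 a ha, hg2 a ha]
        exact h6 a ha
      · rw [hg2 a ha]
        exact h7 a ha
    · rw [hidx g _ hg]
      exact (table_iff h (by omega) hT hg hnb h5).2 ⟨o, hall, rfl⟩

end RAM.Env

/-! ### Tokens of the input word -/

/-- The word that consists of the given tokens, each ended by the letter `2`. -/
def tokenWord (L : List (List (Fin 3))) : List (Fin 3) := (L.map (· ++ [2])).flatten

theorem count_take_append (b w : List (Fin 3)) (hb : 2 ∉ b) (p : ℕ) :
    ((b ++ 2 :: w).take p).count 2 =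
      if p ≤ b.length then 0 else 1 + (w.take (p - b.length - 1)).count 2 := by
  rw [List.take_append, List.count_append,
    List.count_eq_zero_of_not_mem fun h => hb (List.mem_of_mem_take h), zero_add]
  split_ifs with h
  · simp [h]
  · obtain ⟨r, hr⟩ : ∃ r, p - b.length = r + 1 := ⟨p - b.length - 1, by omega⟩
    rw [hr, List.take_succ_cons, List.count_cons_self, add_comm, Nat.add_sub_cancel]

/-- The letter 2 occurs only as an end mark, so counting it before a position yields the number of
the token there; the end mark itself belongs to the token that it closes. -/
theorem exists_token (L : List (List (Fin 3))) (hL : ∀ b ∈ L, 2 ∉ b) {m : ℕ} {b : List (Fin 3)}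
    (hb : L[m]? = some b) : ∃ s, s + b.length < (tokenWord L).length ∧
      (∀ p, ((tokenWord L).take p).count 2 = m ↔ s ≤ p ∧ p ≤ s + b.length) ∧
      (∀ q < b.length, (tokenWord L)[s + q]? = b[q]?) ∧
      (tokenWord L)[s + b.length]? = some 2 := by
  induction L generalizing m with
  | nil => simp at hb
  | cons b' L ih =>
    have hw : tokenWord (b' :: L) = b' ++ 2 :: tokenWord L := by simp [tokenWord]
    have hb' := hL b' (by simp)
    rw [hw]
    rcases m with _ | m
    · obtain rfl : b' = b := by simpa using hb
      refine ⟨0, by simp, fun p => ?_, fun q hq => ?_, by simp⟩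
      · rw [count_take_append _ _ hb']
        split_ifs with h <;> omega
      · rw [zero_add, List.getElem?_append_left hq]
    · obtain ⟨s, h1, h2, h3, h4⟩ := ih (fun b hb => hL b (by simp [hb])) (m := m) (by simpa using hb)
      have hget : ∀ q, (b' ++ 2 :: tokenWord L)[b'.length + 1 + s + q]? =
          (tokenWord L)[s + q]? := by
        intro q
        rw [List.getElem?_append_right (by omega),
          show b'.length + 1 + s + q - b'.length = s + q + 1 by omega, List.getElem?_cons_succ]
      refine ⟨b'.length + 1 + s, by
        rw [List.length_append, List.length_cons]; omega, fun p => ?_, fun q hq => ?_, ?_⟩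
      · rw [count_take_append _ _ hb']
        have := h2 (p - b'.length - 1)
        split_ifs with h
        · exact ⟨False.elim, fun h5 => by omega⟩
        · omega
      · rw [hget, h3 q hq]
      · rw [hget, h4]

theorem List.getElem?_flatten_mul_add {α : Type*} {L : List (List α)} {n : ℕ}
    (h : ∀ l ∈ L, l.length = n) {i j : ℕ} (hj : j < n) :
    L.flatten[i * n + j]? = L[i]?.bind (·[j]?) := by
  induction L generalizing i with
  | nil => simp
  | cons l L ih =>
    have hl := h l (by simp)
    rw [List.flatten_cons]
    rcases i with _ | i
    · rw [List.getElem?_append_left (by omega)]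
      simp
    · rw [List.getElem?_append_right (by rw [hl, Nat.succ_mul]; omega), hl,
        show (i + 1) * n + j - n = i * n + j by rw [Nat.succ_mul]; omega,
        ih fun l hl => h l (by simp [hl])]
      simp

/-- The letters of the binary encoding of a number. -/
def binaryToken (m : ℕ) : List (Fin 3) := m.bits.map fun b => if b then 1 else 0

/-- The letters of the unary encoding of an integer. -/
def unaryToken (z : ℤ) : List (Fin 3) :=
  (if z < 0 then [0] else []) ++ List.replicate z.natAbs 1

theorem two_notMem_binaryToken (m : ℕ) : 2 ∉ binaryToken m := by
  simp only [binaryToken, List.mem_map, not_exists, not_and]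
  rintro b -
  cases b <;> decide

theorem two_notMem_unaryToken (z : ℤ) : 2 ∉ unaryToken z := by
  unfold unaryToken
  split_ifs <;> simp [List.mem_replicate]

theorem sum_binaryToken (m : ℕ) : (∑ q ∈ range (binaryToken m).length,
    if ((binaryToken m)[q]?.getD 0).val = 1 then 2 ^ q else 0) = m := by
  have key : ∀ l : List Bool, (∑ q ∈ range (l.map fun b : Bool => if b then (1 : Fin 3) else 0).length,
      if (((l.map fun b : Bool => if b then (1 : Fin 3) else 0)[q]?.getD 0).val) = 1 then 2 ^ q else 0) =
      Nat.ofDigits 2 (l.map fun b => cond b 1 0) := by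
    intro l
    induction l with
    | nil => simp
    | cons b l ih =>
      rw [List.map_cons, List.map_cons, Nat.ofDigits_cons, ← ih, List.length_cons,
        sum_range_succ', mul_sum, add_comm]
      congr 1
      · cases b <;> simp
      · refine sum_congr rfl fun q _ => ?_
        rw [List.getElem?_cons_succ, pow_succ']
        split_ifs <;> simp
  rw [binaryToken, key, ← Nat.digits_two_eq_bits, Nat.ofDigits_digits]

theorem sum_ite_eq_count (l : List (Fin 3)) :
    (∑ q ∈ range l.length, if (l[q]?.getD 0).val = 1 then 1 else 0) = l.count 1 := by
  induction l with
  | nil => simp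
  | cons x l ih =>
    rw [List.length_cons, sum_range_succ', List.count_cons, ← ih]
    congr 1
    have : (x : ℕ) = 1 ↔ x = 1 := by rw [Fin.ext_iff]; rfl
    simp [this]

theorem count_unaryToken (z : ℤ) : (unaryToken z).count 1 = z.natAbs := by
  unfold unaryToken
  split_ifs <;> simp

theorem zero_mem_unaryToken (z : ℤ) : 0 ∈ unaryToken z ↔ z < 0 := by
  unfold unaryToken
  split_ifs with h <;> simp [List.mem_replicate, h]

/-! ### Reading numbers and matrix entries off the input word -/

namespace RAM.Env

/-- The environment contains the input word `w`. -/
structure Reads (e : Env) (w : List (Fin 3)) : Prop where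
  N_eq : e.N = w.length
  w_eq : e.w = fun i => (w[i]?.getD 0).val
  le_B : w.length ≤ e.B
  two_le : 2 ≤ e.B

variable {e : Env} {scc : Bool} {w : List (Fin 3)}

theorem Reads.tokIdx_eq (h : e.Reads w) (p : ℕ) : e.tokIdx p = (w.take p).count 2 := by
  have key : ∀ (w : List (Fin 3)) (B p : ℕ), w.length ≤ B →
      (∑ q ∈ range B, if q < p ∧ (w[q]?.getD 0).val = 2 then 1 else 0) = (w.take p).count 2 := by
    intro w
    induction w with
    | nil => simp
    | cons x w ih =>
      intro B p hB
      obtain ⟨B, rfl⟩ : ∃ r, B = r + 1 := ⟨B - 1, by simp at hB; omega⟩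
      rcases p with _ | p
      · simp
      · rw [sum_range_succ', List.take_succ_cons, List.count_cons, ← ih B p (by simpa using hB)]
        congr 1
        · simp
        · have : (x : ℕ) = 2 ↔ x = 2 := by rw [Fin.ext_iff]; rfl
          simp [this]
  rw [tokIdx, h.w_eq]
  exact key w e.B p h.le_B

variable {L : List (List (Fin 3))}

/-- The position of a token, in terms of the environment. -/
theorem Reads.exists_token (h : e.Reads (tokenWord L)) (hL : ∀ b ∈ L, 2 ∉ b) {m : ℕ}
    {b : List (Fin 3)} (hb : L[m]? = some b) : ∃ s, s + b.length < e.N ∧ s + b.length < e.B ∧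
      (∀ p, e.tokIdx p = m ↔ s ≤ p ∧ p ≤ s + b.length) ∧
      (∀ q < b.length, e.w (s + q) = (b[q]?.getD 0).val) ∧ e.w (s + b.length) = 2 := by
  obtain ⟨s, h1, h2, h3, h4⟩ := _root_.exists_token L hL hb
  refine ⟨s, by rw [h.N_eq]; exact h1, by have := h.le_B; omega, fun p => ?_, fun q hq => ?_, ?_⟩
  · rw [h.tokIdx_eq, h2]
  · simp only [h.w_eq, h3 q hq]
  · simp only [h.w_eq, h4]
    rfl

theorem sum_token {s l m B : ℕ} {b : List (Fin 3)} (hB : s + l < B)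
    (h1 : ∀ p, e.tokIdx p = m ↔ s ≤ p ∧ p ≤ s + l)
    (h2 : ∀ q < l, e.w (s + q) = (b[q]?.getD 0).val) (h3 : e.w (s + l) = 2) (F : ℕ → ℕ) :
    (∑ p ∈ range B, if e.w p = 1 ∧ e.tokIdx p = m then F p else 0) =
      ∑ q ∈ range l, if (b[q]?.getD 0).val = 1 then F (s + q) else 0 := by
  have h4 : ∑ p ∈ range B, (if e.w p = 1 ∧ e.tokIdx p = m then F p else 0) =
      ∑ p ∈ Ico s (s + l), if e.w p = 1 then F p else 0 := by
    rw [← sum_filter, ← sum_filter]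
    congr 1
    ext p
    simp only [mem_filter, mem_range, mem_Ico, h1]
    constructor
    · rintro ⟨h5, h6, h7, h8⟩
      -- The end mark has the index of its token but carries the letter 2, hence does not
      -- contribute.
      have : p ≠ s + l := by
        rintro rfl
        omega
      omega
    · rintro ⟨⟨h5, h6⟩, h7⟩
      omega
  rw [h4, sum_Ico_eq_sum_range, Nat.add_sub_cancel_left]
  refine sum_congr rfl fun q hq => ?_
  rw [h2 q (mem_range.1 hq)]

theorem Reads.bin_eq (h : e.Reads (tokenWord L)) (hL : ∀ b ∈ L, 2 ∉ b) {m x : ℕ}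
    (hb : L[m]? = some (binaryToken x)) : e.bin m = x := by
  obtain ⟨s, -, h1, h2, h3, h4⟩ := h.exists_token hL hb
  rw [bin, sum_token h1 h2 h3 h4]
  conv_rhs => rw [← sum_binaryToken x]
  refine sum_congr rfl fun q hq => ?_
  rw [mem_range] at hq
  -- The place value of a bit is found by counting the earlier positions of the same token, the
  -- least significant bit being first.
  have h5 : (∑ q' ∈ range e.B, if q' < s + q ∧ e.tokIdx q' = m then 1 else 0) = q := by
    rw [← card_filter]
    have : {q' ∈ range e.B | q' < s + q ∧ e.tokIdx q' = m} = Ico s (s + q) := by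
      ext p
      simp only [mem_filter, mem_range, mem_Ico, h2]
      omega
    rw [this, Nat.card_Ico, Nat.add_sub_cancel_left]
  rw [h5, pow_eq h.two_le (by omega)]

theorem Reads.entry_eq (h : e.Reads (tokenWord L)) (hL : ∀ b ∈ L, 2 ∉ b) {i j : ℕ} {z : ℤ}
    (hb : L[e.cell scc i j]? = some (unaryToken z)) :
    e.value scc i j = z ∧ e.vabs scc i j ≤ e.N := by
  obtain ⟨s, h0, h1, h2, h3, h4⟩ := h.exists_token hL hb
  have habs : e.vabs scc i j = z.natAbs := by
    rw [vabs, sum_token h1 h2 h3 h4, sum_ite_eq_count, count_unaryToken]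
  have hneg : e.vneg scc i j ↔ z < 0 := by
    rw [← zero_mem_unaryToken, vneg]
    constructor
    · rintro ⟨p, -, -, h5, h6⟩
      obtain ⟨h7, h8⟩ := (h2 p).1 h6
      obtain ⟨q, rfl⟩ := Nat.exists_eq_add_of_le h7
      have hq : q < (unaryToken z).length := by
        have : q ≠ (unaryToken z).length := by
          rintro rfl
          omega
        omega
      rw [h3 q hq, List.getElem?_eq_getElem hq, Option.getD_some] at h5
      have h9 : (unaryToken z)[q] = 0 := Fin.ext h5
      rw [← h9]
      exact List.getElem_mem hq
    · intro h5
      obtain ⟨q, hq, h6⟩ := List.getElem_of_mem h5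
      refine ⟨s + q, by omega, by omega, ?_, (h2 _).2 ⟨by omega, by omega⟩⟩
      rw [h3 q hq, List.getElem?_eq_getElem hq, h6]
      rfl
  constructor
  · unfold value vp vn
    rw [habs]
    by_cases hz : z < 0
    · simp only [hneg.2 hz, if_true]
      omega
    · simp only [mt hneg.1 hz, if_false]
      omega
  · rw [habs, ← count_unaryToken]
    have := List.count_le_length (a := (1 : Fin 3)) (l := unaryToken z)
    omega

end RAM.Env

/-! ### From coalition structures to labellings -/

namespace ASHG

variable (Γ : ASHG)

/-- Enumerates a minimum vertex cover without repetition, in the form in which guesses encode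
covers. -/
theorem exists_cover : ∃ u : ℕ → ℕ, (∀ a < Γ.vc, u a < Γ.n) ∧
    (∀ a < Γ.vc, ∀ b < a, u a ≠ u b) ∧
    ∀ i j : Fin Γ.n, Γ.val i j ≠ 0 → ∃ a < Γ.vc, u a = i ∨ u a = j := by
  classical
  obtain ⟨s, hs, hc⟩ := SimpleGraph.vertexCoverNum_exists Γ.graph
  have hcard : #s.toFinset = Γ.vc := by
    have : (#s.toFinset : ℕ∞) = Γ.vc := by
      rw [Γ.coe_vc, ← hs, Set.encard_eq_coe_toFinset_card]
    exact_mod_cast this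
  let φ := s.toFinset.equivFinOfCardEq hcard
  -- The default 0 is taken only at indices from `Γ.vc` on, about which nothing is claimed.
  refine ⟨fun a => if h : a < Γ.vc then ((φ.symm ⟨a, h⟩ : Fin Γ.n) : ℕ) else 0,
    fun a ha => by simp [ha], fun a ha b hb h => ?_, fun i j hij => ?_⟩
  · simp only [ha, hb.trans ha, dif_pos] at h
    have := φ.symm.injective (Subtype.ext (Fin.ext h))
    simp only [Fin.mk.injEq] at this
    omega
  · have hne : i ≠ j := by
      rintro rfl
      exact hij (Γ.val_self i)
    have key : ∀ x ∈ s, ∃ a < Γ.vc,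
        (if h : a < Γ.vc then ((φ.symm ⟨a, h⟩ : Fin Γ.n) : ℕ) else 0) = x := by
      intro x hx
      refine ⟨φ ⟨x, by simpa using hx⟩, (φ _).2, ?_⟩
      simp
    rcases hc (show Γ.graph.Adj i j from ⟨hne, Or.inl hij⟩) with h | h
    · obtain ⟨a, ha, h'⟩ := key i h
      exact ⟨a, ha, Or.inl h'⟩
    · obtain ⟨a, ha, h'⟩ := key j h
      exact ⟨a, ha, Or.inr h'⟩

theorem vc_le : Γ.vc ≤ Γ.n := by
  obtain ⟨u, h1, h2, -⟩ := Γ.exists_cover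
  have := Finset.card_le_card_of_injOn (s := range Γ.vc) (t := range Γ.n) u
    (fun a ha => by simpa using h1 a (by simpa using ha)) (fun a ha b hb h => by
      simp only [coe_range, Set.mem_Iio] at ha hb
      rcases lt_trichotomy a b with h' | h' | h'
      · exact absurd h.symm (h2 b hb a h')
      · exact h'
      · exact absurd h (h2 a ha b h'))
  simpa using this

variable {Γ} {k : ℕ}

theorem isIR_iff (P : Γ.CoalitionStructure) {F : Fin Γ.n → ℕ}
    (hF : ∀ i j, P.part i = P.part j ↔ F i = F j) :
    Γ.IsIR P ↔ ∀ i, 0 ≤ ∑ j, if F i = F j then Γ.val i j else 0 := by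
  refine forall_congr' fun i => ?_
  have h1 : Γ.utility i {i} = 0 := by simp [utility, Γ.val_self]
  have h2 : P.part i = univ.filter fun j => F i = F j := by
    ext j
    simp [P.mem_part_iff_part_eq_part (mem_univ _) (mem_univ _), hF, eq_comm]
  rw [h1, utility, h2, sum_filter]

/-- Labels are the positions in the enumeration of the coalitions, and the fibres of a labelling are
the coalitions. `1 + (lb j - 1)` is the maximum of 1 and `lb j`: positivity makes fibres nonempty
and excludes no coalition structure. -/
theorem feasible_iff_exists_structure {lb ub : Fin k → ℕ} {lb' ub' : ℕ → ℕ} {v : ℕ → ℕ → ℤ}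
    (hlb : ∀ j : Fin k, lb' j = 1 + (lb j - 1)) (hub : ∀ j : Fin k, ub' j = ub j)
    (hv : ∀ i j : Fin Γ.n, v i j = Γ.val i j) :
    Feasible Γ.n k lb' ub' v ↔ ∃ (P : Γ.CoalitionStructure) (e : Fin k ≃ P.parts),
      (∀ j, lb j ≤ (e j).val.card ∧ (e j).val.card ≤ ub j) ∧ Γ.IsIR P := by
  classical
  have hcard : ∀ (f : ℕ → ℕ) (j : ℕ), #{i ∈ range Γ.n | f i = j} =
      #{i : Fin Γ.n | f i = j} := fun f j => by
    rw [card_filter, card_filter, Finset.sum_range]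
  have hsum : ∀ (f : ℕ → ℕ) (i : Fin Γ.n), (∑ i' ∈ range Γ.n, if f i = f i' then v i i' else 0) =
      ∑ j : Fin Γ.n, if f i = f j then Γ.val i j else 0 := fun f i => by
    rw [Finset.sum_range]
    simp only [hv]
  constructor
  · rintro ⟨f, hf, hs, hr⟩
    let fib (j : Fin k) : Finset (Fin Γ.n) := {i | f i = j}
    have hmem : ∀ i j, i ∈ fib j ↔ f i = j := fun i j => by simp [fib]
    have hfib : ∀ j : Fin k, lb' j ≤ #(fib j) ∧ #(fib j) ≤ ub' j := fun j => by
      have := hs j j.2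
      rwa [hcard] at this
    have hne : ∀ j, (fib j).Nonempty := fun j => by
      rw [← card_pos]
      have := (hfib j).1
      rw [hlb] at this
      omega
    let P : Γ.CoalitionStructure := Finpartition.ofExistsUnique (univ.image fib)
      (fun p _ => subset_univ p) (fun i _ => by
        refine ⟨fib ⟨f i, hf i i.2⟩, ⟨mem_image_of_mem _ (mem_univ _), (hmem _ _).2 rfl⟩, ?_⟩
        rintro t ⟨ht, hit⟩
        obtain ⟨j, -, rfl⟩ := mem_image.1 ht
        rw [hmem] at hit
        congr 1
        exact Fin.ext hit.symm) (fun h => by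
        obtain ⟨j, -, hj⟩ := mem_image.1 h
        exact (hne j).ne_empty hj)
    have hparts : P.parts = univ.image fib := rfl
    have hinj : Function.Injective fib := fun j j' h => by
      obtain ⟨i, hi⟩ := hne j
      have hi' := hi
      rw [h] at hi'
      rw [hmem] at hi hi'
      exact Fin.ext (hi.symm.trans hi')
    have hpart : ∀ i : Fin Γ.n, P.part i = fib ⟨f i, hf i i.2⟩ := fun i =>
      P.part_eq_of_mem (by rw [hparts]; exact mem_image_of_mem _ (mem_univ _)) ((hmem _ _).2 rfl)
    let φ : Fin k → P.parts := fun j => ⟨fib j, by rw [hparts]; exact mem_image_of_mem _ (mem_univ _)⟩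
    have hφ : Function.Bijective φ := by
      refine ⟨fun j j' h => hinj (congrArg Subtype.val h), ?_⟩
      rintro ⟨t, ht⟩
      obtain ⟨j, -, rfl⟩ := mem_image.1 (hparts ▸ ht)
      exact ⟨j, rfl⟩
    refine ⟨P, Equiv.ofBijective φ hφ, fun j => ?_, ?_⟩
    · have := hfib j
      rw [hlb, hub] at this
      exact ⟨by change lb j ≤ #(fib j); omega, this.2⟩
    · rw [isIR_iff P (F := fun i => f i) fun i j => by
        rw [hpart, hpart, hinj.eq_iff, Fin.mk.injEq]]
      intro i
      rw [← hsum]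
      exact hr i i.2
  · rintro ⟨P, e, hs, hr⟩
    let F (i : Fin Γ.n) : Fin k := e.symm ⟨P.part i, P.part_mem.2 (mem_univ _)⟩
    let f (i : ℕ) : ℕ := if h : i < Γ.n then F ⟨i, h⟩ else 0
    have hf : ∀ i : Fin Γ.n, f i = F i := fun i => by simp [f]
    have hFP : ∀ i j, F i = j ↔ P.part i = e j := fun i j => by
      simp only [F]
      rw [Equiv.symm_apply_eq, Subtype.ext_iff]
    have hfib : ∀ j : Fin k, #{i ∈ range Γ.n | f i = j} = #(e j).val := fun j => by
      rw [hcard]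
      congr 1
      ext i
      simp only [mem_filter, mem_univ, true_and, hf, Fin.val_inj, hFP]
      constructor
      · intro h
        rw [← h]
        exact P.mem_part (mem_univ _)
      · intro h
        exact P.part_eq_of_mem (e j).2 h
    refine ⟨f, fun i hi => ?_, fun j hj => ?_, fun i hi => ?_⟩
    · rw [hf ⟨i, hi⟩]
      exact (F ⟨i, hi⟩).2
    · have h1 := hfib ⟨j, hj⟩
      have h2 := hs ⟨j, hj⟩
      have h3 := hlb ⟨j, hj⟩
      have h4 := hub ⟨j, hj⟩
      -- Nonemptiness supplies the raised lower bound when `lb` is 0.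
      have h5 : 0 < #(e ⟨j, hj⟩).val := card_pos.2 (P.nonempty_of_mem_parts (e _).2)
      simp only at h1 h3 h4
      omega
    · rw [isIR_iff P (F := fun i => f i) fun i j => by
        rw [hf, hf, Fin.val_inj, hFP]
        simp [F]] at hr
      have := hr ⟨i, hi⟩
      rwa [← hsum] at this

end ASHG

/-- The bounds 1 and `n` hold for every coalition, so only the number of coalitions is prescribed.
-/
theorem KASHG.admitsIR_iff (Γ : KASHG) : Γ.AdmitsIR ↔
    ∃ (P : Γ.CoalitionStructure) (e : Fin Γ.k ≃ P.parts),
      (∀ j, 1 ≤ (e j).val.card ∧ (e j).val.card ≤ Γ.n) ∧ Γ.IsIR P := by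
  refine exists_congr fun P => ?_
  constructor
  · rintro ⟨h, hr⟩
    refine ⟨(P.parts.equivFinOfCardEq h).symm, fun j => ⟨?_, ?_⟩, hr⟩
    · exact card_pos.2 (P.nonempty_of_mem_parts (Subtype.prop _))
    · exact (card_le_univ _).trans_eq (Fintype.card_fin _)
  · rintro ⟨e, -, hr⟩
    have := Fintype.card_congr e
    simp only [Fintype.card_fin, Fintype.card_coe] at this
    exact ⟨this.symm, hr⟩

/-! ### The common solver -/

namespace RAM

theorem AnswersWithin.mono {p : Prog} {w : List (Fin 3)} {Q : Prop} {T T' : ℕ}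
    (h : AnswersWithin p w Q T) (hT : T ≤ T') : AnswersWithin p w Q T' := by
  obtain ⟨t, s, h1, h2, h3⟩ := h
  exact ⟨t, s, h1, h2.trans hT, h3⟩

/-- A program for all games whose input words are read correctly. -/
theorem exists_solver (scc : Bool) : ∃ (p : Prog) (D : ℕ), ∀ (Γ : ASHG) (w : List (Fin 3))
    (Q : Prop), 2 ≤ w.length → Γ.n ≤ w.length →
    (∀ e : Env, e.Reads w → e.n = Γ.n ∧
      (∀ i j : Fin Γ.n, e.value scc i j = Γ.val i j ∧ e.vabs scc i j ≤ e.N) ∧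
      (Feasible e.n e.k (e.lb scc) (e.ub scc) (e.value scc) ↔ Q)) →
    AnswersWithin p w Q (w.length ^ (D * max 1 Γ.vc)) := by
  obtain ⟨p, D, h⟩ := exists_answersWithin (found := fun e => e.Found scc)
    (ans := fun e => e.Answer scc) (step := fun e => e.step scc) .found .answer (.step (.var 0))
  refine ⟨p, D, fun Γ w Q hw hn H => ?_⟩
  have hvc : Γ.vc ≤ w.length := Γ.vc_le.trans hn
  have hA : ∀ c ≤ w.length, ∀ T, (levelEnv w c T).Adequate := fun c hc T => ⟨hw, hc, rfl⟩
  have hR : ∀ c T, (levelEnv w c T).Reads w := fun c T =>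
    ⟨rfl, rfl, Nat.le_self_pow (by omega) _,
      hw.trans (Nat.le_self_pow (n := 16 * (c + 1) + 1) (by omega) _)⟩
  obtain ⟨u, hu1, hu2, hu3⟩ := Γ.exists_cover
  -- The word is read correctly at every level: here at level `Γ.vc`, to show that the search stops
  -- there at the latest, and below at the level `c` where it stops.
  obtain ⟨hn0, hv0, -⟩ := H _ (hR Γ.vc fun _ => 0)
  obtain ⟨c, hc, hf, T, hT, ha⟩ := h w hw Γ.vc hvc
    (Env.found_of_cover (hA _ hvc _) (by rw [hn0]; exact hn) (u := u)
      (fun a ha => by rw [hn0]; exact hu1 a ha) hu2 (fun i hi j hj hij => by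
        rw [hn0] at hi hj
        have := (hv0 ⟨i, hi⟩ ⟨j, hj⟩).1
        simp only at this
        rw [this] at hij
        exact hu3 ⟨i, hi⟩ ⟨j, hj⟩ hij))
  obtain ⟨hn1, hv1, hQ⟩ := H _ (hR c T)
  have hiff := (Env.answer_iff (hA c (hc.trans hvc) T) (by rw [hn1]; exact hn)
    (fun i hi j hj => by
      rw [hn1] at hi hj
      exact (hv1 ⟨i, hi⟩ ⟨j, hj⟩).2) hT hf).trans hQ
  rwa [propext hiff] at ha

end RAM

/-! ### Encodings as sequences of tokens -/

theorem length_tokenWord_le {L : List (List (Fin 3))} {X : ℕ} (h : ∀ b ∈ L, b.length ≤ X) :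
    (tokenWord L).length ≤ L.length * (X + 1) := by
  induction L with
  | nil => simp [tokenWord]
  | cons b L ih =>
    have h1 := ih fun b hb => h b (by simp [hb])
    have h2 := h b (by simp)
    simp only [tokenWord, List.map_cons, List.flatten_cons, List.length_append, List.length_cons,
      List.length_nil] at h1 ⊢
    rw [Nat.succ_mul]
    omega

theorem le_length_tokenWord (L : List (List (Fin 3))) : L.length ≤ (tokenWord L).length := by
  induction L with
  | nil => simp
  | cons b L ih =>
    simp only [tokenWord, List.map_cons, List.flatten_cons, List.length_append, List.length_cons,
      List.length_nil] at ih ⊢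
    omega

/-- A crude bound suffices, since only polynomial dependence on `n` is needed. -/
theorem length_binaryToken_le (m : ℕ) : (binaryToken m).length ≤ m := by
  rw [binaryToken, List.length_map, Nat.size_eq_bits_len]
  exact Nat.size_le.2 Nat.lt_two_pow_self

theorem length_unaryToken_le (z : ℤ) : (unaryToken z).length ≤ z.natAbs + 1 := by
  unfold unaryToken
  split_ifs <;> simp

namespace ASHG

variable (Γ : ASHG)

/-- The tokens of the matrix. -/
def valTokens : List (List (Fin 3)) :=
  (List.ofFn fun i => List.ofFn fun j => unaryToken (Γ.val i j)).flatten

theorem encodeVal_eq : Γ.encodeVal = tokenWord Γ.valTokens := by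
  simp only [encodeVal, tokenWord, valTokens, List.map_flatten, List.map_ofFn, List.flatten_flatten]
  congr 2
  funext i
  simp only [Function.comp, List.map_ofFn]
  rfl

theorem getElem?_valTokens (i j : Fin Γ.n) :
    Γ.valTokens[(i : ℕ) * Γ.n + j]? = some (unaryToken (Γ.val i j)) := by
  rw [valTokens, List.getElem?_flatten_mul_add (fun l hl => by
    obtain ⟨i, rfl⟩ := (List.mem_ofFn' _ _).1 hl
    simp) j.2]
  simp

theorem length_valTokens : Γ.valTokens.length = Γ.n * Γ.n := by
  simp [valTokens, List.length_flatten, Function.comp_def]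

theorem mem_valTokens {b : List (Fin 3)} (hb : b ∈ Γ.valTokens) :
    ∃ i j, b = unaryToken (Γ.val i j) := by
  simp only [valTokens, List.mem_flatten, List.mem_ofFn] at hb
  obtain ⟨l, ⟨i, rfl⟩, hb⟩ := hb
  obtain ⟨j, rfl⟩ := (List.mem_ofFn' _ _).1 hb
  exact ⟨i, j, rfl⟩

end ASHG

theorem two_notMem_valTokens {Γ : ASHG} {b : List (Fin 3)} (hb : b ∈ Γ.valTokens) : 2 ∉ b := by
  obtain ⟨i, j, rfl⟩ := Γ.mem_valTokens hb
  exact two_notMem_unaryToken _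

theorem RAM.Env.lb_true (e : RAM.Env) (j : ℕ) : e.lb true j = 1 + (e.bin (2 + (j + j)) - 1) := rfl

theorem RAM.Env.ub_true (e : RAM.Env) (j : ℕ) : e.ub true j = e.bin (2 + (j + j) + 1) := rfl

/-! ### Input words of games with `k` coalitions -/

namespace KASHG

variable (Γ : KASHG)

/-- The tokens of the input word. -/
def tokens : List (List (Fin 3)) := binaryToken Γ.n :: binaryToken Γ.k :: Γ.valTokens

theorem encode_eq : Γ.encode = tokenWord Γ.tokens := by
  rw [encode, ASHG.encodeVal_eq]
  simp [tokens, tokenWord, encodeBinary, binaryToken]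

theorem two_notMem_tokens : ∀ b ∈ Γ.tokens, 2 ∉ b := by
  simp only [tokens, List.mem_cons]
  rintro b (rfl | rfl | hb)
  · exact two_notMem_binaryToken _
  · exact two_notMem_binaryToken _
  · exact two_notMem_valTokens hb

theorem length_tokens : Γ.tokens.length = Γ.n * Γ.n + 2 := by
  simp [tokens, ASHG.length_valTokens]

theorem length_le : Γ.n * Γ.n + 2 ≤ Γ.encode.length := by
  rw [encode_eq, ← length_tokens]
  exact le_length_tokenWord _

theorem reads_iff {e : RAM.Env} (h : e.Reads Γ.encode) : e.n = Γ.n ∧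
    (∀ i j : Fin Γ.n, e.value false i j = Γ.val i j ∧ e.vabs false i j ≤ e.N) ∧
    (Feasible e.n e.k (e.lb false) (e.ub false) (e.value false) ↔ Γ.AdmitsIR) := by
  have hB : Γ.n ≤ e.B := by
    have := h.le_B
    have := Γ.length_le
    nlinarith
  rw [encode_eq] at h
  have hL := Γ.two_notMem_tokens
  have hn : e.n = Γ.n := h.bin_eq hL rfl
  have hk : e.k = Γ.k := h.bin_eq hL rfl
  have hv : ∀ i j : Fin Γ.n, e.value false i j = Γ.val i j ∧ e.vabs false i j ≤ e.N := by
    intro i j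
    refine h.entry_eq hL ?_
    rw [RAM.Env.cell, RAM.Env.mul_eq (by omega), hn, RAM.Env.offset, cond_false, tokens, add_comm]
    exact Γ.getElem?_valTokens i j
  refine ⟨hn, hv, ?_⟩
  rw [admitsIR_iff, hn, hk]
  exact ASHG.feasible_iff_exists_structure (fun j => rfl) (fun j => hn) fun i j => (hv i j).1

/-- Turns a bound in the word length into one in `n`. There are `n * n + 2 ≤ n ^ 3` tokens, each of
length at most `n + n ^ d` without its end mark, and `n + n ^ d + 1 ≤ n ^ d * n ^ 3`; both estimates
rely on `n ≥ 2`. -/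
theorem length_encode_le {d : ℕ} (hn : 2 ≤ Γ.n) (hv : ∀ i j, |Γ.val i j| ≤ (Γ.n : ℤ) ^ d)
    (hk : Γ.k ≤ Γ.n ^ d) : Γ.encode.length ≤ Γ.n ^ (d + 6) := by
  have ha : 1 ≤ Γ.n ^ d := Nat.one_le_pow _ _ (by omega)
  have h1 : ∀ b ∈ Γ.tokens, b.length ≤ Γ.n + Γ.n ^ d := by
    simp only [tokens, List.mem_cons]
    rintro b (rfl | rfl | hb)
    · exact (length_binaryToken_le _).trans (by omega)
    · exact (length_binaryToken_le _).trans (by omega)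
    · obtain ⟨i, j, rfl⟩ := Γ.mem_valTokens hb
      have h2 := hv i j
      have h3 : (Γ.val i j).natAbs ≤ Γ.n ^ d := by
        zify
        exact h2
      exact (length_unaryToken_le _).trans (by omega)
  rw [encode_eq]
  refine (length_tokenWord_le h1).trans ?_
  rw [length_tokens]
  rw [pow_add]
  generalize Γ.n ^ d = a at *
  have h4 : Γ.n * Γ.n + 2 ≤ Γ.n ^ 3 := by nlinarith
  have h5 : Γ.n + a + 1 ≤ a * Γ.n ^ 3 := by
    have h6 : Γ.n + 2 ≤ Γ.n ^ 3 := by nlinarith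
    have h7 := Nat.mul_le_mul_left a h6
    have h8 := Nat.mul_le_mul_right Γ.n ha
    linarith
  calc _ ≤ Γ.n ^ 3 * (a * Γ.n ^ 3) := Nat.mul_le_mul h4 h5
    _ = a * Γ.n ^ 6 := by ring

end KASHG

/-! ### Input words of games with size constraints -/

namespace ASHGSCC

variable (Γ : ASHGSCC)

/-- The tokens of the size bounds. -/
def sizeTokens : List (List (Fin 3)) :=
  (List.ofFn fun j => [binaryToken (Γ.lb j), binaryToken (Γ.ub j)]).flatten

/-- The tokens of the input word. -/
def tokens : List (List (Fin 3)) :=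
  binaryToken Γ.n :: binaryToken Γ.k :: (Γ.sizeTokens ++ Γ.valTokens)

theorem encode_eq : Γ.encode = tokenWord Γ.tokens := by
  rw [encode, ASHG.encodeVal_eq]
  have : (List.ofFn fun j => encodeBinary (Γ.lb j) ++ encodeBinary (Γ.ub j)).flatten =
      tokenWord Γ.sizeTokens := by
    simp only [tokenWord, sizeTokens, List.map_flatten, List.map_ofFn, List.flatten_flatten]
    congr 2
    funext j
    simp [encodeBinary, binaryToken]
  rw [this]
  simp [tokens, tokenWord, encodeBinary, binaryToken]

theorem mem_sizeTokens {b : List (Fin 3)} (hb : b ∈ Γ.sizeTokens) :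
    ∃ j, b = binaryToken (Γ.lb j) ∨ b = binaryToken (Γ.ub j) := by
  simp only [sizeTokens, List.mem_flatten, List.mem_ofFn] at hb
  obtain ⟨l, ⟨j, rfl⟩, hb⟩ := hb
  exact ⟨j, by simpa using hb⟩

theorem two_notMem_tokens : ∀ b ∈ Γ.tokens, 2 ∉ b := by
  simp only [tokens, List.mem_cons, List.mem_append]
  rintro b (rfl | rfl | hb | hb)
  · exact two_notMem_binaryToken _
  · exact two_notMem_binaryToken _
  · obtain ⟨j, rfl | rfl⟩ := Γ.mem_sizeTokens hb <;> exact two_notMem_binaryToken _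
  · exact two_notMem_valTokens hb

theorem length_sizeTokens : Γ.sizeTokens.length = Γ.k + Γ.k := by
  simp [sizeTokens, List.length_flatten, Function.comp_def]
  ring

theorem getElem?_sizeTokens (j : Fin Γ.k) :
    Γ.sizeTokens[(j : ℕ) + j]? = some (binaryToken (Γ.lb j)) ∧
    Γ.sizeTokens[(j : ℕ) + j + 1]? = some (binaryToken (Γ.ub j)) := by
  have h : ∀ l ∈ List.ofFn fun j => [binaryToken (Γ.lb j), binaryToken (Γ.ub j)],
      l.length = 2 := by
    intro l hl
    obtain ⟨i, rfl⟩ := (List.mem_ofFn' _ _).1 hl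
    rfl
  have h1 := List.getElem?_flatten_mul_add h (i := j) (j := 0) (by omega)
  have h2 := List.getElem?_flatten_mul_add h (i := j) (j := 1) (by omega)
  rw [sizeTokens, ← mul_two]
  refine ⟨h1.trans ?_, h2.trans ?_⟩ <;> simp

theorem length_tokens : Γ.tokens.length = Γ.k + Γ.k + Γ.n * Γ.n + 2 := by
  simp [tokens, ASHG.length_valTokens, length_sizeTokens]

theorem length_le : Γ.k + Γ.k + Γ.n * Γ.n + 2 ≤ Γ.encode.length := by
  rw [encode_eq, ← length_tokens]
  exact le_length_tokenWord _

theorem reads_iff {e : RAM.Env} (h : e.Reads Γ.encode) : e.n = Γ.n ∧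
    (∀ i j : Fin Γ.n, e.value true i j = Γ.val i j ∧ e.vabs true i j ≤ e.N) ∧
    (Feasible e.n e.k (e.lb true) (e.ub true) (e.value true) ↔ Γ.AdmitsIR) := by
  have hB : Γ.n ≤ e.B := by
    have := h.le_B
    have := Γ.length_le
    nlinarith
  rw [encode_eq] at h
  have hL := Γ.two_notMem_tokens
  have hn : e.n = Γ.n := h.bin_eq hL rfl
  have hk : e.k = Γ.k := h.bin_eq hL rfl
  have hget : ∀ m, Γ.tokens[2 + m]? = (Γ.sizeTokens ++ Γ.valTokens)[m]? := fun m => by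
    rw [add_comm]
    rfl
  have hv : ∀ i j : Fin Γ.n, e.value true i j = Γ.val i j ∧ e.vabs true i j ≤ e.N := by
    intro i j
    refine h.entry_eq hL ?_
    rw [RAM.Env.cell, RAM.Env.mul_eq (by omega), hn, RAM.Env.offset, cond_true, hk, add_assoc,
      hget, List.getElem?_append_right (by rw [length_sizeTokens]; omega), length_sizeTokens,
      Nat.add_sub_cancel_left]
    exact Γ.getElem?_valTokens i j
  refine ⟨hn, hv, ?_⟩
  rw [hn, hk]
  refine ASHG.feasible_iff_exists_structure (fun j => ?_) (fun j => ?_) fun i j => (hv i j).1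
  · rw [RAM.Env.lb_true, h.bin_eq hL (x := Γ.lb j)]
    rw [hget, List.getElem?_append_left (by rw [length_sizeTokens]; omega)]
    exact (Γ.getElem?_sizeTokens j).1
  · rw [RAM.Env.ub_true, h.bin_eq hL (x := Γ.ub j)]
    rw [add_assoc, hget, List.getElem?_append_left (by rw [length_sizeTokens]; omega)]
    exact (Γ.getElem?_sizeTokens j).2

/-- The `2k` additional tokens raise the bound on their number to `n ^ d * n ^ 3`, whence the second
`d` in the exponent. Lower bounds are controlled through the upper ones. -/
theorem length_encode_le {d : ℕ} (hn : 2 ≤ Γ.n) (hv : ∀ i j, |Γ.val i j| ≤ (Γ.n : ℤ) ^ d)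
    (hk : Γ.k ≤ Γ.n ^ d) (hub : ∀ j, Γ.ub j ≤ Γ.n ^ d) :
    Γ.encode.length ≤ Γ.n ^ (d + d + 6) := by
  have ha : 1 ≤ Γ.n ^ d := Nat.one_le_pow _ _ (by omega)
  have h1 : ∀ b ∈ Γ.tokens, b.length ≤ Γ.n + Γ.n ^ d := by
    simp only [tokens, List.mem_cons, List.mem_append]
    rintro b (rfl | rfl | hb | hb)
    · exact (length_binaryToken_le _).trans (by omega)
    · exact (length_binaryToken_le _).trans (by omega)
    · obtain ⟨j, hj⟩ := Γ.mem_sizeTokens hb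
      have h2 := hub j
      have h3 := Γ.lb_le_ub j
      rcases hj with rfl | rfl <;> exact (length_binaryToken_le _).trans (by omega)
    · obtain ⟨i, j, rfl⟩ := Γ.mem_valTokens hb
      have h2 := hv i j
      have h3 : (Γ.val i j).natAbs ≤ Γ.n ^ d := by
        zify
        exact h2
      exact (length_unaryToken_le _).trans (by omega)
  rw [encode_eq]
  refine (length_tokenWord_le h1).trans ?_
  rw [length_tokens]
  rw [pow_add, pow_add]
  generalize Γ.n ^ d = a at *
  have h4 : Γ.k + Γ.k + Γ.n * Γ.n + 2 ≤ a * Γ.n ^ 3 := by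
    have h6 : 4 + Γ.n * Γ.n ≤ Γ.n ^ 3 := by nlinarith
    have h7 := Nat.mul_le_mul_left a h6
    have h8 := Nat.mul_le_mul_right (Γ.n * Γ.n) ha
    linarith
  have h5 : Γ.n + a + 1 ≤ a * Γ.n ^ 3 := by
    have h6 : Γ.n + 2 ≤ Γ.n ^ 3 := by nlinarith
    have h7 := Nat.mul_le_mul_left a h6
    have h8 := Nat.mul_le_mul_right Γ.n ha
    linarith
  calc _ ≤ a * Γ.n ^ 3 * (a * Γ.n ^ 3) := Nat.mul_le_mul h4 h5
    _ = a * a * Γ.n ^ 6 := by ring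

end ASHGSCC

theorem mainTheorem3 :
    (∃ p : RAM.Prog,
      (∃ c : ℕ, ∀ Γ : KASHG,
        RAM.AnswersWithin p Γ.encode Γ.AdmitsIR (Γ.encode.length ^ (c * max 1 Γ.vc))) ∧
      (∀ d : ℕ, ∃ c : ℕ, ∀ Γ : KASHG, 2 ≤ Γ.n →
        (∀ i j, |Γ.val i j| ≤ (Γ.n : ℤ) ^ d) → Γ.k ≤ Γ.n ^ d →
        RAM.AnswersWithin p Γ.encode Γ.AdmitsIR (Γ.n ^ (c * max 1 Γ.vc)))) ∧
    (∃ p : RAM.Prog,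
      (∃ c : ℕ, ∀ Γ : ASHGSCC,
        RAM.AnswersWithin p Γ.encode Γ.AdmitsIR (Γ.encode.length ^ (c * max 1 Γ.vc))) ∧
      (∀ d : ℕ, ∃ c : ℕ, ∀ Γ : ASHGSCC, 2 ≤ Γ.n →
        (∀ i j, |Γ.val i j| ≤ (Γ.n : ℤ) ^ d) → Γ.k ≤ Γ.n ^ d → (∀ j, Γ.ub j ≤ Γ.n ^ d) →
        RAM.AnswersWithin p Γ.encode Γ.AdmitsIR (Γ.n ^ (c * max 1 Γ.vc)))) := by
  constructor
  · obtain ⟨p, D, hp⟩ := RAM.exists_solver false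
    have key : ∀ Γ : KASHG,
        RAM.AnswersWithin p Γ.encode Γ.AdmitsIR (Γ.encode.length ^ (D * max 1 Γ.vc)) := by
      intro Γ
      have := Γ.length_le
      exact hp Γ.toASHG _ _ (by omega) (by nlinarith) fun e he => Γ.reads_iff he
    -- The same program serves both bounds; the word length is at most `n ^ (d + 6)`, which
    -- multiplies the exponent by `d + 6`.
    refine ⟨p, ⟨D, key⟩, fun d => ⟨(d + 6) * D, fun Γ hn hv hk => (key Γ).mono ?_⟩⟩
    rw [mul_assoc, pow_mul Γ.n]
    exact Nat.pow_le_pow_left (Γ.length_encode_le hn hv hk) _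
  · obtain ⟨p, D, hp⟩ := RAM.exists_solver true
    have key : ∀ Γ : ASHGSCC,
        RAM.AnswersWithin p Γ.encode Γ.AdmitsIR (Γ.encode.length ^ (D * max 1 Γ.vc)) := by
      intro Γ
      have := Γ.length_le
      exact hp Γ.toASHG _ _ (by omega) (by nlinarith) fun e he => Γ.reads_iff he
    refine ⟨p, ⟨D, key⟩, fun d => ⟨(d + d + 6) * D, fun Γ hn hv hk hub => (key Γ).mono ?_⟩⟩
    rw [mul_assoc, pow_mul Γ.n]
    exact Nat.pow_le_pow_left (Γ.length_encode_le hn hv hk hub) _
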